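/- Let $N\ge 8$ be an even integer that is not a multiple of $3$, and let $M=N/2$. For $\gamma\ge 0$ consider the potential $$V_\gamma(x)=\sum_{i\in\mathbb Z/N\mathbb Z}\Bigl(\tfrac14x_i^4-\tfrac12x_i^2\Bigr)+\frac\gamma4\sum_{i\in\mathbb Z/N\mathbb Z}(x_{i+1}-x_i)^2$$ restricted to the hyperplane $S=\{x\in\mathbb R^{\mathbb Z/N\mathbb Z}:\sum_i x_i=0\}$. *Metastable hierarchy.* For a local minimum $x$ of $V_\gamma|_S$ and a set $A\subset S$, let $$H_\gamma(x,A)=\inf_{\varphi}\ \sup_{t\in[0,1]}V_\gamma(\varphi(t))-V_\gamma(x),$$ the infimum being over all continuous $\varphi:[0,1]\to S$ with $\varphi(0)=x$ and $\varphi(1)\in A$. A partition of a set of local minima of $V_\gamma|_S$ into nonempty sets $P_1,\dots,P_m$ is a *metastable hierarchy*, written $P_1\prec P_2\prec\dots\prec P_m$, if there is $\theta>0$ such that $$H_\gamma\Bigl(x,\bigcup_{i=1}^{k-1}P_i\Bigr)\le\min_{y\in P_\ell}H_\gamma\Bigl(y,\bigcup_{i=1}^{k}P_i\setminus P_\ell\Bigr)-\theta$$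 for all $2\le k\le m$, all $x\in P_k$ and all $1\le\ell\le k-1$. *Particle/hole configurations.* Let $B_0$ be the set of local minima of $V_0|_S$ whose coordinates take exactly two values, each of them $M$ times, both being roots of $\xi^3-\xi=\lambda$ for some $\lambda$ for which this equation has three distinct real roots (these are the points with $M$ coordinates $+1$ and $M$ coordinates $-1$). For $x\in B_0$, the number of interfaces is the number of $i\in\mathbb Z/N\mathbb Z$ with $x_i\ne x_{i+1}$, and a site $i$ is isolated if $x_{i-1}\ne x_i\ne x_{i+1}$. Let $A_2$ be the set of $x\in B_0$ with $2$ interfaces. For even $p$ with $4\le p\le M$, let $A_p$ (respectively $A'_p$) be the set of $x\in B_0$ with $p$ interfaces and at least one isolated site (respectively, no isolated site). For even $p$ with $M<p\le N$, let $A_p$ be the set of $x\in B_0$ with $p$ interfaces. Let $M'$ be the largest even number that is at most $M$. **Theorem.** There is $\gamma_0>0$ (depending on $N$) such that each $x\in B_0$ is the starting point $x(0)=x$ of exactly one continuous curve $[0,\gamma_0)\ni\gamma\mapsto x(\gamma)\in S$ for which $x(\gamma)$ is a stationary point of $V_\gamma|_S$ for all $\gamma$. For all $0<\gamma<\gamma_0$,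 the points $x(\gamma)$ with $x\in B_0$ are pairwise distinct local minima of $V_\gamma|_S$, and with $A_p(\gamma)=\{x(\gamma):x\in A_p\}$ and $A'_p(\gamma)=\{x(\gamma):x\in A'_p\}$ these families partition $B_0(\gamma)=\{x(\gamma):x\in B_0\}$ and form a metastable hierarchy of $V_\gamma|_S$: $$A_2(\gamma)\prec A'_4(\gamma)\prec A'_6(\gamma)\prec\dots\prec A'_{M'}(\gamma)\prec A_4(\gamma)\prec A_6(\gamma)\prec\dots\prec A_{N-2}(\gamma)\prec A_N(\gamma).$$ -/

import Mathlib

noncomputable section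

namespace MassAC

/-! ### Metastable hierarchies of a potential on a topological space -/

section General

variable {X : Type*} [TopologicalSpace X]

/-- Communication height from `x` to the set `A`: the infimum, over the continuous paths from `x`
to a point of `A`, of the maximal value of `V` on the path, minus `V x`. -/
def commHeight (V : X → ℝ) (x : X) (A : Set X) : ℝ :=
  sInf {h : ℝ | ∃ y ∈ A, ∃ p : Path x y, h = ⨆ t : unitInterval, V (p t)} - V x

/-- `P 0 ≺ P 1 ≺ … ≺ P (m - 1)`: the sets `P k` form a partition of the set `T` of local minima
of `V`, and this partition is a metastable hierarchy. -/
structure IsMetastableHierarchy (V : X → ℝ) (T : Set X) {m : ℕ} (P : Fin m → Set X) : Prop where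
  isLocalMin : ∀ x ∈ T, IsLocalMin V x
  nonempty : ∀ k, (P k).Nonempty
  disjoint : ∀ k l, k ≠ l → Disjoint (P k) (P l)
  cover : ⋃ k, P k = T
  gap : ∃ θ : ℝ, 0 < θ ∧ ∀ k l : Fin m, l < k → ∀ x ∈ P k, ∀ y ∈ P l,
    commHeight V x (⋃ i : Fin m, ⋃ _ : i < k, P i) ≤
      commHeight V y ((⋃ i : Fin m, ⋃ _ : i ≤ k, P i) \ P l) - θ

end General

/-! ### The potential, constrained to the hyperplane of zero total mass -/

/-- The on-site double-well potential. -/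
def U (ξ : ℝ) : ℝ := ξ ^ 4 / 4 - ξ ^ 2 / 2

variable (N : ℕ) [NeZero N]

/-- The potential on `ℝ^Λ`, where `Λ = ℤ/Nℤ` is the periodic lattice. -/
def potential (γ : ℝ) (x : EuclideanSpace ℝ (ZMod N)) : ℝ :=
  ∑ i, U (x i) + γ / 4 * ∑ i, (x (i + 1) - x i) ^ 2

/-- The hyperplane `S` of points whose coordinates sum to zero. -/
def hyperplane : Submodule ℝ (EuclideanSpace ℝ (ZMod N)) where
  carrier := {x | ∑ i, x i = 0}
  add_mem' := by
    intro a b ha hb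
    simp only [Set.mem_ofPred_eq] at ha hb ⊢
    simp [Finset.sum_add_distrib, ha, hb]
  zero_mem' := by simp
  smul_mem' := by
    intro c x hx
    simp only [Set.mem_ofPred_eq] at hx ⊢
    simp [← Finset.mul_sum, hx]

/-- The restriction of the potential to the hyperplane. -/
def V (γ : ℝ) (x : hyperplane N) : ℝ := potential N γ x

variable {N}

/-- Stationary points of the constrained potential: its differential on the hyperplane vanishes. -/
def IsStationary (γ : ℝ) (x : hyperplane N) : Prop := fderiv ℝ (V N γ) x = 0

/-! ### Particle/hole configurations -/

/-- The number of sites at which `x` takes the value `α`. -/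
def occurrences (x : hyperplane N) (α : ℝ) : ℕ :=
  (Finset.univ.filter fun i : ZMod N => x.1 i = α).card

/-- All coordinates of `x` are roots of `ξ ^ 3 - ξ = lam`, for a `lam` for which this equation has
three distinct real roots, and these roots, suitably ordered, occur `a₀`, `a₁`, `a₂` times. -/
def HasTriple (x : hyperplane N) (a₀ a₁ a₂ : ℕ) : Prop :=
  ∃ lam α₀ α₁ α₂ : ℝ, α₀ ≠ α₁ ∧ α₀ ≠ α₂ ∧ α₁ ≠ α₂ ∧
    α₀ ^ 3 - α₀ = lam ∧ α₁ ^ 3 - α₁ = lam ∧ α₂ ^ 3 - α₂ = lam ∧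
    (∀ i, x.1 i = α₀ ∨ x.1 i = α₁ ∨ x.1 i = α₂) ∧
    occurrences x α₀ = a₀ ∧ occurrences x α₁ = a₁ ∧ occurrences x α₂ = a₂

variable (N) in
/-- The family `B₀`: local minima of the uncoupled constrained potential with triple
`(0, M, M)`, where `M = N / 2`. -/
def B₀ : Set (hyperplane N) := {x | IsLocalMin (V N 0) x ∧ HasTriple x 0 (N / 2) (N / 2)}

/-- The number of interfaces of a configuration. -/
def interfaces (x : hyperplane N) : ℕ :=
  (Finset.univ.filter fun i : ZMod N => x.1 i ≠ x.1 (i + 1)).card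

/-- The site `i` is isolated: it has an interface on both sides. -/
def IsIsolated (x : hyperplane N) (i : ZMod N) : Prop :=
  x.1 (i - 1) ≠ x.1 i ∧ x.1 i ≠ x.1 (i + 1)

variable (N) in
/-- Configurations in `B₀` with `p` interfaces and, if `4 ≤ p ≤ M`, at least one isolated site. -/
def A (p : ℕ) : Set (hyperplane N) :=
  {x ∈ B₀ N | interfaces x = p ∧ (4 ≤ p → p ≤ N / 2 → ∃ i, IsIsolated x i)}

variable (N) in
/-- Configurations in `B₀` with `p` interfaces and no isolated site. -/
def A' (p : ℕ) : Set (hyperplane N) :=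
  {x ∈ B₀ N | interfaces x = p ∧ ∀ i, ¬ IsIsolated x i}

variable (N) in
/-- The families in the order `A 2, A' 4, A' 6, …, A' M', A 4, A 6, …, A N`, where `M = N / 2` and
`M' = 2 * (M / 2)` is the largest even number that is at most `M`. -/
def families : List (Set (hyperplane N)) :=
  [A N 2] ++ (List.range (N / 2 / 2 - 1)).map (fun j => A' N (2 * j + 4))
    ++ (List.range (N / 2 - 1)).map (fun j => A N (2 * j + 4))

/-! ### Continuation to positive coupling -/

/-- `c` is a continuous branch, defined for coupling `0 ≤ γ < γ₀`, of stationary points of the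
constrained potential, starting at `x₀` for zero coupling. -/
structure IsContinuation (γ₀ : ℝ) (x₀ : hyperplane N) (c : ℝ → hyperplane N) : Prop where
  zero : c 0 = x₀
  continuousOn : ContinuousOn c (Set.Ico 0 γ₀)
  isStationary : ∀ γ ∈ Set.Ico 0 γ₀, IsStationary γ (c γ)

end MassAC

end

noncomputable section

namespace MassAC

variable {N : ℕ} [NeZero N]

/-! ### Configurations with coordinates `±1` -/

/-! Write m = N/2. The potential is `excess` − N/4 + (γ/4)·`gradSq`, and the points of `B₀` are the
balanced ±1 configurations, which are exactly the zeros of `excess` on the hyperplane. For γ = 0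
they are all equally deep, and the lowest passes out of them all have the same height `height N`.
The hierarchy is therefore decided at first order in γ.

The lowest pass out of a configuration s moves one site i to the central root of ξ³ − ξ = λ. Up to a
global sign the saddle has coordinates −t at i, (m−1)t at the other sites like i, and −(m−2)t at the
sites unlike i, with t = `thr N`. If s has I interfaces and i has D unlike neighbours, the
first-order energy of this saddle is `lev N I D`, against I for s itself. Since `lev` decreases in
D, leaving s costs `height N` + γ·`cost s` up to o(γ), where `cost` uses the largest D available: 2
if there is an isolated site, 1 otherwise. The cost decreases with I, and the presence of an
isolated site lowers it more than any change of I can compensate (`cost_lt_of_maxUnlike_eq`,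
`cost_lt_of_isolated`). This is the order of the families.

Lower bounds come from a neighbourhood `basin s`. On its frontier either some coordinate is at the
central root, and a tangent-line (Lagrange multiplier) estimate makes the saddle the minimizer with
quadratic growth (`saddle_growth`), or two unlike sites share a value, which is strictly more
expensive (`exists_excess_ge_of_eq`). Quadratic growth reduces the effect of the coupling to its
value at the saddle, up to O(γ²).

Upper bounds come from explicit paths. Segments lead from a saddle down to s and down to a `valley`;
a valley is shared by the two configurations that differ by exchanging a particle and a hole. Chains
of such exchanges bring any configuration with at least 4 interfaces to one with 2 interfaces, never
above its first level (`exists_reach_two`), hence to a configuration of larger cost.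

Existence and uniqueness of the branches x(γ) follow from quadratic growth of the potential around
stationary points in a box about each configuration. -/

/-- The on-site energy, normalized to have minimal value zero. -/
def excess (x : hyperplane N) : ℝ := ∑ i, (x.1 i ^ 2 - 1) ^ 2 / 4

/-- The discrete Dirichlet energy. -/
def gradSq (x : hyperplane N) : ℝ := ∑ i, (x.1 (i + 1) - x.1 i) ^ 2

/-- All coordinates of `s` are `1` or `-1`. -/
def IsConfig (s : hyperplane N) : Prop := ∀ i, s.1 i = 1 ∨ s.1 i = -1

theorem V_eq (γ : ℝ) (x : hyperplane N) :
    V N γ x = excess x - N / 4 + γ / 4 * gradSq x := by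
  have h : ∑ i : ZMod N, U (x.1 i) = excess x - N / 4 := by
    have : (N : ℝ) / 4 = ∑ _i : ZMod N, (1 / 4 : ℝ) := by
      simp [ZMod.card]; ring
    rw [this, excess, ← Finset.sum_sub_distrib]
    exact Finset.sum_congr rfl fun i _ => by unfold U; ring
  simp only [V, potential, gradSq, h]

theorem sum_eq_zero (x : hyperplane N) : ∑ i, x.1 i = 0 := x.2

theorem excess_nonneg (x : hyperplane N) : 0 ≤ excess x :=
  Finset.sum_nonneg fun _ _ => by positivity

theorem gradSq_nonneg (x : hyperplane N) : 0 ≤ gradSq x :=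
  Finset.sum_nonneg fun _ _ => by positivity

theorem continuous_excess : Continuous (excess : hyperplane N → ℝ) := by
  unfold excess; fun_prop

theorem continuous_gradSq : Continuous (gradSq : hyperplane N → ℝ) := by
  unfold gradSq; fun_prop

theorem continuous_V (γ : ℝ) : Continuous (V N γ) := by
  have : V N γ = fun x => excess x - N / 4 + γ / 4 * gradSq x := funext (V_eq γ)
  rw [this]
  have := continuous_excess (N := N)
  have := continuous_gradSq (N := N)
  fun_prop

theorem IsConfig.sq {s : hyperplane N} (hs : IsConfig s) (i : ZMod N) : s.1 i ^ 2 = 1 := by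
  rcases hs i with h | h <;> rw [h] <;> norm_num

theorem IsConfig.mul_self {s : hyperplane N} (hs : IsConfig s) (i : ZMod N) :
    s.1 i * s.1 i = 1 := by
  rw [← pow_two, hs.sq]

theorem IsConfig.abs {s : hyperplane N} (hs : IsConfig s) (i : ZMod N) : |s.1 i| = 1 := by
  rcases hs i with h | h <;> rw [h] <;> norm_num

theorem IsConfig.eq_neg {s : hyperplane N} (hs : IsConfig s) {i j : ZMod N}
    (h : s.1 i ≠ s.1 j) : s.1 j = -s.1 i := by
  rcases hs i with h1 | h1 <;> rcases hs j with h2 | h2 <;>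
    first
    | exact absurd (h1.trans h2.symm) h
    | simp [h1, h2]

theorem IsConfig.ne_neg {s : hyperplane N} (hs : IsConfig s) (i : ZMod N) :
    s.1 i ≠ -s.1 i := by
  rcases hs i with h | h <;> rw [h] <;> norm_num

theorem IsConfig.excess_eq_zero {s : hyperplane N} (hs : IsConfig s) : excess s = 0 :=
  Finset.sum_eq_zero fun i _ => by rw [hs.sq]; norm_num

theorem isConfig_finite : {s : hyperplane N | IsConfig s}.Finite := by
  have h : {f : ZMod N → ℝ | ∀ i, f i ∈ ({1, -1} : Set ℝ)}.Finite :=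
    Set.Finite.pi' fun _ => by simp
  refine Set.Finite.of_finite_image (f := fun s : hyperplane N => fun i => s.1 i) (h.subset ?_) ?_
  · rintro _ ⟨s, hs, rfl⟩ i
    simpa using hs i
  · intro s _ s' _ h
    ext i
    exact congrFun h i

theorem card_config_pos {s : hyperplane N} (hs : IsConfig s) (a : ℝ) (ha : a = 1 ∨ a = -1) :
    (occurrences s a : ℝ) = N / 2 := by
  have h : (occurrences s a : ℝ) = ∑ i : ZMod N, (1 + a * s.1 i) / 2 := by
    rw [occurrences, Finset.card_filter]
    push_cast
    refine Finset.sum_congr rfl fun i _ => ?_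
    rcases ha with rfl | rfl <;> rcases hs i with h | h <;> rw [h] <;> norm_num
  rw [h, ← Finset.sum_div, Finset.sum_add_distrib, ← Finset.mul_sum, sum_eq_zero]
  simp [ZMod.card]

/-- With no coordinate at the first root, zero mass makes the other two roots opposite; opposite
roots of ξ³ − ξ = λ force λ = 0, and being nonzero they are ±1. Conversely configurations are zeros
of `excess`, hence global minima. -/
theorem mem_B₀_iff (hN2 : Even N) {s : hyperplane N} : s ∈ B₀ N ↔ IsConfig s := by
  have hN : 0 < N := Nat.pos_of_ne_zero (NeZero.ne N)
  obtain ⟨n, rfl⟩ := hN2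
  have hn : 0 < n := by omega
  have hnn : (n + n) / 2 = n := by omega
  constructor
  · rintro ⟨-, lam, α₀, α₁, α₂, h01, h02, h12, e0, e1, e2, hc, c0, c1, c2⟩
    rw [hnn] at c1 c2
    have hc' : ∀ i, s.1 i = α₁ ∨ s.1 i = α₂ := by
      intro i
      rcases hc i with h | h
      · have : i ∈ Finset.univ.filter fun i : ZMod (n + n) => s.1 i = α₀ := by simp [h]
        rw [Finset.card_eq_zero.1 c0] at this
        simp at this
      · exact h
    have hsum : (n : ℝ) * α₁ + n * α₂ = 0 := by
      rw [← sum_eq_zero s]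
      have : ∀ i, s.1 i = (if s.1 i = α₁ then α₁ else 0) + (if s.1 i = α₂ then α₂ else 0) := by
        intro i
        rcases hc' i with h | h <;> simp [h, h12, h12.symm]
      rw [Finset.sum_congr rfl fun i _ => this i, Finset.sum_add_distrib, ← Finset.sum_filter,
        ← Finset.sum_filter, Finset.sum_const, Finset.sum_const, nsmul_eq_mul, nsmul_eq_mul]
      rw [← occurrences.eq_def, ← occurrences.eq_def, c1, c2]
    have hneg : α₂ = -α₁ := by
      have : (n : ℝ) * (α₁ + α₂) = 0 := by linarith
      rcases mul_eq_zero.1 this with h | h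
      · exact absurd (Nat.cast_eq_zero.1 h) hn.ne'
      · linarith
    subst hneg
    have h1 : α₁ ≠ 0 := fun h => h12 (by simp [h])
    have h2 : α₁ ^ 2 = 1 := by
      have : α₁ * (α₁ ^ 2 - 1) = 0 := by linarith
      rcases mul_eq_zero.1 this with h | h
      · exact absurd h h1
      · linarith
    rcases mul_self_eq_one_iff.1 ((pow_two α₁).symm.trans h2) with h | h
    all_goals
      subst h
      intro i
      have := hc' i
      simp only [neg_neg] at this
      tauto
  · intro hs
    refine ⟨Filter.Eventually.of_forall fun y => ?_, 0, 0, 1, -1, by norm_num, by norm_num,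
      by norm_num, by norm_num, by norm_num, by norm_num, fun i => Or.inr (hs i), ?_, ?_, ?_⟩
    · rw [V_eq, V_eq, hs.excess_eq_zero]
      have := excess_nonneg y
      linarith
    · refine Finset.card_eq_zero.2 (Finset.filter_eq_empty_iff.2 fun i _ h => ?_)
      have := hs.sq i
      rw [h] at this
      norm_num at this
    all_goals
      rw [hnn]
      refine Nat.cast_injective (R := ℝ) ?_
      rw [card_config_pos hs _ (by simp)]
      push_cast
      ring

theorem IsConfig.interfaces_eq {s : hyperplane N} (hs : IsConfig s) :
    (interfaces s : ℝ) = ∑ i, (1 - s.1 i * s.1 (i + 1)) / 2 := by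
  rw [interfaces, Finset.card_filter]
  push_cast
  refine Finset.sum_congr rfl fun i _ => ?_
  rcases hs i with h | h <;> rcases hs (i + 1) with h' | h' <;> rw [h, h'] <;> norm_num

theorem IsConfig.gradSq_eq {s : hyperplane N} (hs : IsConfig s) :
    gradSq s = 4 * interfaces s := by
  rw [hs.interfaces_eq, gradSq, Finset.mul_sum]
  refine Finset.sum_congr rfl fun i _ => ?_
  linear_combination hs.sq i + hs.sq (i + 1)

theorem interfaces_le (s : hyperplane N) : interfaces s ≤ N := by
  refine (Finset.card_filter_le _ _).trans ?_
  simp [ZMod.card]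

/-- The product of all bonds s_i s_{i+1} around the cycle is a product of squares, and each
interface contributes −1 to it. -/
theorem IsConfig.even_interfaces {s : hyperplane N} (hs : IsConfig s) : Even (interfaces s) := by
  have h1 : ∏ i, s.1 i * s.1 (i + 1) = 1 := by
    have h := Equiv.prod_comp (Equiv.addRight (1 : ZMod N)) (fun i => s.1 i)
    simp only [Equiv.coe_addRight] at h
    rw [Finset.prod_mul_distrib, h, ← Finset.prod_mul_distrib]
    exact Finset.prod_eq_one fun i _ => hs.mul_self i
  have h2 : ∏ i, s.1 i * s.1 (i + 1) = (-1) ^ interfaces s := by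
    rw [interfaces, ← Finset.prod_const, Finset.prod_filter]
    refine Finset.prod_congr rfl fun i _ => ?_
    rcases hs i with h | h <;> rcases hs (i + 1) with h' | h' <;> rw [h, h'] <;> norm_num
  rw [h1] at h2
  by_contra h
  rw [Nat.not_even_iff_odd] at h
  rw [h.neg_one_pow] at h2
  norm_num at h2

/-- A function on the cycle that does not change along edges is constant. -/
theorem eq_of_forall_succ_eq {α : Type*} {f : ZMod N → α} (h : ∀ i, f (i + 1) = f i)
    (i j : ZMod N) : f i = f j := by
  have key : ∀ n : ℕ, f (n : ZMod N) = f 0 := by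
    intro n
    induction n with
    | zero => simp
    | succ k ih => rw [Nat.cast_succ, h, ih]
  have h' : ∀ i, f i = f 0 := fun i => by rw [← ZMod.natCast_zmod_val i, key]
  rw [h' i, h' j]

theorem IsConfig.interfaces_ne_zero {s : hyperplane N} (hs : IsConfig s) : interfaces s ≠ 0 := by
  intro h
  have h' : ∀ i, s.1 (i + 1) = s.1 i := by
    intro i
    by_contra hne
    have : i ∈ Finset.univ.filter fun i : ZMod N => s.1 i ≠ s.1 (i + 1) := by
      simpa using Ne.symm hne
    rw [Finset.card_eq_zero.1 h] at this
    simp at this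
  have hz := sum_eq_zero s
  rw [Finset.sum_congr rfl fun i _ => eq_of_forall_succ_eq h' i 0] at hz
  simp only [Finset.sum_const, Finset.card_univ, ZMod.card, nsmul_eq_mul, mul_eq_zero,
    Nat.cast_eq_zero, NeZero.ne N, false_or] at hz
  have := hs.sq 0
  rw [hz] at this
  norm_num at this

theorem IsConfig.two_le_interfaces {s : hyperplane N} (hs : IsConfig s) : 2 ≤ interfaces s := by
  obtain ⟨k, hk⟩ := hs.even_interfaces
  have := hs.interfaces_ne_zero
  omega

/-! ### Continuation of the minima to positive coupling -/

theorem sum_shift (f : ZMod N → ℝ) : ∑ i, f (i + 1) = ∑ i, f i := by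
  have h := Equiv.sum_comp (Equiv.addRight (1 : ZMod N)) f
  simpa only [Equiv.coe_addRight] using h

/-- If the uncoupled energy grows quadratically around `z`, the coupling lowers the energy
below its value at `z` only to second order. -/
theorem V_ge_of_quadratic_growth {x z : hyperplane N} {h κ γ : ℝ} (hκ : 0 < κ) (hγ : 0 ≤ γ)
    (hz : ∀ k, |z.1 k| ≤ 2) (hx : h + κ * ∑ k, (x.1 k - z.1 k) ^ 2 ≤ excess x) :
    h - N / 4 + γ / 4 * gradSq z - N * (4 * γ ^ 2 / κ) ≤ V N γ x := by
  have h1 : -16 * ∑ k, |x.1 k - z.1 k| ≤ gradSq x - gradSq z := by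
    have : -16 * ∑ k, |x.1 k - z.1 k|
        = ∑ k, -8 * (|x.1 (k + 1) - z.1 (k + 1)| + |x.1 k - z.1 k|) := by
      rw [← Finset.mul_sum, Finset.sum_add_distrib, sum_shift fun k => |x.1 k - z.1 k|]
      ring
    rw [this, gradSq, gradSq, ← Finset.sum_sub_distrib]
    refine Finset.sum_le_sum fun k _ => ?_
    set a := x.1 (k + 1) - z.1 (k + 1) with ha
    set b := x.1 k - z.1 k with hb
    have hd : |z.1 (k + 1) - z.1 k| ≤ 4 := by
      have := abs_sub (z.1 (k + 1)) (z.1 k)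
      linarith [hz k, hz (k + 1)]
    have e : (x.1 (k + 1) - x.1 k) ^ 2 - (z.1 (k + 1) - z.1 k) ^ 2
        = 2 * ((z.1 (k + 1) - z.1 k) * (a - b)) + (a - b) ^ 2 := by rw [ha, hb]; ring
    rw [e]
    have h2 : |(z.1 (k + 1) - z.1 k) * (a - b)| ≤ 4 * (|a| + |b|) := by
      rw [abs_mul]
      exact mul_le_mul hd (abs_sub a b) (abs_nonneg _) (by norm_num)
    have := neg_abs_le ((z.1 (k + 1) - z.1 k) * (a - b))
    nlinarith [sq_nonneg (a - b)]
  have h2 : -(N * (4 * γ ^ 2 / κ)) ≤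
      κ * ∑ k, (x.1 k - z.1 k) ^ 2 - 4 * γ * ∑ k, |x.1 k - z.1 k| := by
    have e : -(N * (4 * γ ^ 2 / κ)) = ∑ _k : ZMod N, -(4 * γ ^ 2 / κ) := by
      simp [ZMod.card]
    rw [e, Finset.mul_sum, Finset.mul_sum, ← Finset.sum_sub_distrib]
    refine Finset.sum_le_sum fun k _ => ?_
    -- Completes the square in |x_k − z_k|; the linear coefficient is 16·γ/4 = 4γ.
    have e2 : κ * (x.1 k - z.1 k) ^ 2 - 4 * γ * |x.1 k - z.1 k| + 4 * γ ^ 2 / κ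
        = (κ * |x.1 k - z.1 k| - 2 * γ) ^ 2 / κ := by
      rw [← sq_abs (x.1 k - z.1 k)]
      field_simp
      ring
    have := div_nonneg (sq_nonneg (κ * |x.1 k - z.1 k| - 2 * γ)) hκ.le
    linarith
  rw [V_eq]
  have h3 := mul_le_mul_of_nonneg_left h1 (div_nonneg hγ (by norm_num : (0 : ℝ) ≤ 4))
  nlinarith

/-- The differential of the potential at `y` in the direction `v`. -/
def dV (γ : ℝ) (y v : hyperplane N) : ℝ :=
  ∑ i, (y.1 i ^ 3 - y.1 i) * v.1 i
    + γ / 2 * ∑ i, (y.1 (i + 1) - y.1 i) * (v.1 (i + 1) - v.1 i)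

/-- The expansion is exact: (z² − 1)²/4 minus its tangent at y factors as (z − y)²(z² + 2zy + 3y² −
2)/4. Growth estimates thus only need a lower bound on the last factor. -/
theorem V_taylor (γ : ℝ) (y z : hyperplane N) :
    V N γ z = V N γ y + dV γ y (z - y)
      + ∑ i, (z.1 i - y.1 i) ^ 2 * (z.1 i ^ 2 + 2 * z.1 i * y.1 i + 3 * y.1 i ^ 2 - 2) / 4
      + γ / 4 * gradSq (z - y) := by
  rw [V_eq, V_eq, dV]
  have e1 : excess z = excess y + ∑ i, (y.1 i ^ 3 - y.1 i) * (z - y).1 i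
      + ∑ i, (z.1 i - y.1 i) ^ 2 * (z.1 i ^ 2 + 2 * z.1 i * y.1 i + 3 * y.1 i ^ 2 - 2) / 4 := by
    rw [excess, excess, ← Finset.sum_add_distrib, ← Finset.sum_add_distrib]
    refine Finset.sum_congr rfl fun i _ => ?_
    simp only [Submodule.coe_sub, PiLp.sub_apply]
    ring
  have e2 : gradSq z = gradSq y
      + 2 * ∑ i, (y.1 (i + 1) - y.1 i) * ((z - y).1 (i + 1) - (z - y).1 i) + gradSq (z - y) := by
    rw [gradSq, gradSq, gradSq, Finset.mul_sum, ← Finset.sum_add_distrib,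
      ← Finset.sum_add_distrib]
    refine Finset.sum_congr rfl fun i _ => ?_
    simp only [Submodule.coe_sub, PiLp.sub_apply]
    ring
  rw [e1, e2]
  ring

theorem differentiable_V (γ : ℝ) : Differentiable ℝ (V N γ) := by
  have h : V N γ = fun x => excess x - N / 4 + γ / 4 * gradSq x := funext (V_eq γ)
  have hc : ∀ i, Differentiable ℝ fun x : hyperplane N => x.1 i := fun i =>
    ((EuclideanSpace.proj i : EuclideanSpace ℝ (ZMod N) →L[ℝ] ℝ).comp
      (hyperplane N).subtypeL).differentiable
  rw [h]
  unfold excess gradSq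
  fun_prop

theorem IsStationary.dV_eq_zero {γ : ℝ} {y : hyperplane N} (hy : IsStationary γ y)
    (v : hyperplane N) : dV γ y v = 0 := by
  have hline : HasDerivAt (fun s : ℝ => y + s • v) v 0 := by
    simpa using ((hasDerivAt_id (0 : ℝ)).smul_const v).const_add y
  have h1 : HasDerivAt (fun s : ℝ => V N γ (y + s • v)) 0 0 := by
    have hd : HasFDerivAt (V N γ) (0 : hyperplane N →L[ℝ] ℝ) (y + (0 : ℝ) • v) := by
      have := (differentiable_V γ y).hasFDerivAt
      rw [show fderiv ℝ (V N γ) y = 0 from hy] at this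
      simpa using this
    exact hd.comp_hasDerivAt (0 : ℝ) hline
  have hq : ∀ a b : ℝ, HasDerivAt (fun s : ℝ => a + s * b) b 0 := fun a b => by
    simpa using ((hasDerivAt_id (0 : ℝ)).mul_const b).const_add a
  have h2 : HasDerivAt (fun s : ℝ => V N γ (y + s • v)) (dV γ y v) 0 := by
    have e : (fun s : ℝ => V N γ (y + s • v)) = fun s : ℝ =>
        ∑ i, ((y.1 i + s * v.1 i) ^ 2 - 1) ^ 2 / 4 - (N : ℝ) / 4
        + γ / 4 * ∑ i, (y.1 (i + 1) - y.1 i + s * (v.1 (i + 1) - v.1 i)) ^ 2 := by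
      funext s
      rw [V_eq, excess, gradSq]
      simp only [Submodule.coe_add, Submodule.coe_smul, PiLp.add_apply, PiLp.smul_apply,
        smul_eq_mul]
      congr 2
      refine Finset.sum_congr rfl fun i _ => ?_
      ring
    rw [e, dV]
    have h3 : HasDerivAt (fun s : ℝ => ∑ i, ((y.1 i + s * v.1 i) ^ 2 - 1) ^ 2 / 4)
        (∑ i, (y.1 i ^ 3 - y.1 i) * v.1 i) 0 := by
      refine HasDerivAt.fun_sum fun i _ => ?_
      refine (((((hq (y.1 i) (v.1 i)).fun_pow 2).sub_const 1).fun_pow 2).div_const 4).congr_deriv ?_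
      norm_num
      ring
    have h4 : HasDerivAt
        (fun s : ℝ => ∑ i, (y.1 (i + 1) - y.1 i + s * (v.1 (i + 1) - v.1 i)) ^ 2)
        (2 * ∑ i, (y.1 (i + 1) - y.1 i) * (v.1 (i + 1) - v.1 i)) 0 := by
      rw [Finset.mul_sum]
      refine HasDerivAt.fun_sum fun i _ => ?_
      refine ((hq (y.1 (i + 1) - y.1 i) (v.1 (i + 1) - v.1 i)).fun_pow 2).congr_deriv ?_
      norm_num
      ring
    refine ((h3.sub_const ((N : ℝ) / 4)).add (h4.const_mul (γ / 4))).congr_deriv ?_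
    ring
  exact h2.unique h1

/-- The box of radius `1 / 10` around a configuration. -/
def box (s : hyperplane N) : Set (hyperplane N) := {x | ∀ i, |x.1 i - s.1 i| ≤ 1 / 10}

theorem mem_box_self (s : hyperplane N) : s ∈ box s := fun i => by simp

theorem IsConfig.mul_mem_box {s x : hyperplane N} (hs : IsConfig s) (hx : x ∈ box s)
    (i : ZMod N) : 9 / 10 ≤ s.1 i * x.1 i ∧ s.1 i * x.1 i ≤ 11 / 10 := by
  have := abs_le.1 (hx i)
  rcases hs i with h | h <;> rw [h] at this ⊢ <;> constructor <;> linarith [this.1, this.2]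

theorem isCompact_box (s : hyperplane N) : IsCompact (box s) := by
  refine Metric.isCompact_of_isClosed_isBounded ?_ ?_
  · have : box s = ⋂ i, {x : hyperplane N | |x.1 i - s.1 i| ≤ 1 / 10} := by
      ext x; simp [box]
    rw [this]
    exact isClosed_iInter fun i => isClosed_le (by fun_prop) continuous_const
  · refine (Metric.isBounded_closedBall (x := s) (r := √(∑ _i : ZMod N, (1 / 10) ^ 2))).subset ?_
    intro x hx
    rw [Metric.mem_closedBall, Subtype.dist_eq, EuclideanSpace.dist_eq]
    refine Real.sqrt_le_sqrt (Finset.sum_le_sum fun i _ => ?_)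
    rw [Real.dist_eq]
    exact pow_le_pow_left₀ (abs_nonneg _) (hx i) 2

/-- In the box s_i y_i and s_i z_i are at least 9/10, so the last factor of `V_taylor` exceeds
6·(81/100) − 2 > 2, and the coupling remainder is nonnegative. This plays the role of strict
convexity. -/
theorem IsConfig.quadratic_growth_box {s y z : hyperplane N} (hs : IsConfig s) {γ : ℝ}
    (hγ : 0 ≤ γ) (hy : y ∈ box s) (hz : z ∈ box s) (hst : IsStationary γ y) :
    V N γ y + (∑ i, (z.1 i - y.1 i) ^ 2) / 2 ≤ V N γ z := by
  rw [V_taylor γ y z, hst.dV_eq_zero, Finset.sum_div]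
  have h : ∑ i, (z.1 i - y.1 i) ^ 2 / 2 ≤ ∑ i, (z.1 i - y.1 i) ^ 2
      * (z.1 i ^ 2 + 2 * z.1 i * y.1 i + 3 * y.1 i ^ 2 - 2) / 4 := by
    refine Finset.sum_le_sum fun i _ => ?_
    have h1 := (hs.mul_mem_box hy i).1
    have h2 := (hs.mul_mem_box hz i).1
    have e : z.1 i ^ 2 + 2 * z.1 i * y.1 i + 3 * y.1 i ^ 2 - 2
        = (s.1 i * z.1 i) ^ 2 + 2 * (s.1 i * z.1 i) * (s.1 i * y.1 i)
          + 3 * (s.1 i * y.1 i) ^ 2 - 2 := by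
      linear_combination (-(z.1 i ^ 2 + 2 * z.1 i * y.1 i + 3 * y.1 i ^ 2)) * hs.sq i
    have : 2 ≤ z.1 i ^ 2 + 2 * z.1 i * y.1 i + 3 * y.1 i ^ 2 - 2 := by rw [e]; nlinarith
    nlinarith [mul_le_mul_of_nonneg_left this (sq_nonneg (z.1 i - y.1 i))]
  have := mul_nonneg (div_nonneg hγ (by norm_num : (0 : ℝ) ≤ 4)) (gradSq_nonneg (z - y))
  linarith

theorem eq_of_sum_sq_nonpos {y z : hyperplane N} (h : ∑ i, (z.1 i - y.1 i) ^ 2 ≤ 0) : z = y := by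
  have h0 := (Finset.sum_eq_zero_iff_of_nonneg fun i _ => sq_nonneg (z.1 i - y.1 i)).1
    (le_antisymm h (Finset.sum_nonneg fun i _ => sq_nonneg _))
  ext i
  have := pow_eq_zero_iff (two_ne_zero) |>.1 (h0 i (Finset.mem_univ i))
  linarith

theorem IsConfig.stationary_unique {s y z : hyperplane N} (hs : IsConfig s) {γ : ℝ}
    (hγ : 0 ≤ γ) (hy : y ∈ box s) (hz : z ∈ box s) (hsy : IsStationary γ y)
    (hsz : IsStationary γ z) : z = y := by
  have h1 := hs.quadratic_growth_box hγ hy hz hsy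
  have h2 := hs.quadratic_growth_box hγ hz hy hsz
  refine eq_of_sum_sq_nonpos ?_
  have h3 := Finset.sum_nonneg fun i (_ : i ∈ (Finset.univ : Finset (ZMod N))) =>
    sq_nonneg (y.1 i - z.1 i)
  linarith

/-- The minimizer of the potential in the box around `s`. -/
def branch (s : hyperplane N) (γ : ℝ) : hyperplane N :=
  ((isCompact_box s).exists_isMinOn ⟨s, mem_box_self s⟩ (continuous_V γ).continuousOn).choose

theorem branch_mem (s : hyperplane N) (γ : ℝ) : branch s γ ∈ box s :=
  ((isCompact_box s).exists_isMinOn ⟨s, mem_box_self s⟩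
    (continuous_V γ).continuousOn).choose_spec.1

theorem branch_isMinOn (s : hyperplane N) (γ : ℝ) : IsMinOn (V N γ) (box s) (branch s γ) :=
  ((isCompact_box s).exists_isMinOn ⟨s, mem_box_self s⟩
    (continuous_V γ).continuousOn).choose_spec.2

theorem IsConfig.V_eq {s : hyperplane N} (hs : IsConfig s) (γ : ℝ) :
    V N γ s = -(N / 4) + γ * interfaces s := by
  rw [MassAC.V_eq, hs.excess_eq_zero, hs.gradSq_eq]; ring

theorem IsConfig.V_branch_le {s : hyperplane N} (hs : IsConfig s) (γ : ℝ) :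
    V N γ (branch s γ) ≤ -(N / 4) + γ * interfaces s :=
  (branch_isMinOn s γ (mem_box_self s)).trans (hs.V_eq γ).le

theorem IsConfig.excess_ge {s x : hyperplane N} (hs : IsConfig s) (hx : x ∈ box s) :
    (9 / 10) * ∑ i, (x.1 i - s.1 i) ^ 2 ≤ excess x := by
  rw [Finset.mul_sum]
  refine Finset.sum_le_sum fun i _ => ?_
  have h1 := (hs.mul_mem_box hx i).1
  have e : (x.1 i ^ 2 - 1) ^ 2 = (x.1 i - s.1 i) ^ 2 * (1 + s.1 i * x.1 i) ^ 2 := by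
    rcases hs i with h | h <;> rw [h] <;> ring
  rw [e]
  have : (19 / 10) ^ 2 ≤ (1 + s.1 i * x.1 i) ^ 2 := by nlinarith
  nlinarith [mul_le_mul_of_nonneg_left this (sq_nonneg (x.1 i - s.1 i))]

/-- Comparison with the energy at s gives (9/10)·Σ(x_i − s_i)² ≤ γN < 1/200, so each square is below
1/100. The minimizer is interior to the box, hence a true local minimum. -/
theorem IsConfig.abs_branch_sub_lt {s : hyperplane N} (hs : IsConfig s) {γ : ℝ} (hγ : 0 ≤ γ)
    (hγ1 : γ * N < 1 / 200) (i : ZMod N) : |(branch s γ).1 i - s.1 i| < 1 / 10 := by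
  have h1 := hs.V_branch_le γ
  have h2 := hs.excess_ge (branch_mem s γ)
  have h3 := mul_nonneg (div_nonneg hγ (by norm_num : (0 : ℝ) ≤ 4)) (gradSq_nonneg (branch s γ))
  rw [MassAC.V_eq] at h1
  have h4 : γ * interfaces s ≤ γ * N :=
    mul_le_mul_of_nonneg_left (by exact_mod_cast interfaces_le s) hγ
  have h5 := Finset.single_le_sum (f := fun i => ((branch s γ).1 i - s.1 i) ^ 2)
    (fun i _ => sq_nonneg _) (Finset.mem_univ i)
  refine abs_lt_of_sq_lt_sq ?_ (by norm_num)
  simp only at h5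
  linarith

theorem box_mem_nhds {s x : hyperplane N} (hx : ∀ i, |x.1 i - s.1 i| < 1 / 10) :
    box s ∈ nhds x := by
  have ho : IsOpen {x : hyperplane N | ∀ i, |x.1 i - s.1 i| < 1 / 10} := by
    rw [Set.ofPred_forall]
    exact isOpen_iInter_of_finite fun i => isOpen_lt (by fun_prop) continuous_const
  exact Filter.mem_of_superset (ho.mem_nhds hx) fun y hy i => (hy i).le

theorem IsConfig.isLocalMin_branch {s : hyperplane N} (hs : IsConfig s) {γ : ℝ} (hγ : 0 ≤ γ)
    (hγ1 : γ * N < 1 / 200) : IsLocalMin (V N γ) (branch s γ) :=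
  (branch_isMinOn s γ).isLocalMin (box_mem_nhds (hs.abs_branch_sub_lt hγ hγ1))

theorem IsConfig.isStationary_branch {s : hyperplane N} (hs : IsConfig s) {γ : ℝ} (hγ : 0 ≤ γ)
    (hγ1 : γ * N < 1 / 200) : IsStationary γ (branch s γ) :=
  (hs.isLocalMin_branch hγ hγ1).fderiv_eq_zero

theorem IsConfig.isStationary_zero {s : hyperplane N} (hs : IsConfig s) :
    IsStationary 0 s := by
  refine IsLocalMin.fderiv_eq_zero (Filter.Eventually.of_forall fun y => ?_)
  rw [MassAC.V_eq, MassAC.V_eq, hs.excess_eq_zero]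
  have := excess_nonneg y
  linarith

theorem IsConfig.branch_zero {s : hyperplane N} (hs : IsConfig s) : branch s 0 = s :=
  hs.stationary_unique le_rfl (mem_box_self s) (branch_mem s 0) hs.isStationary_zero
    (hs.isStationary_branch le_rfl (by norm_num))

theorem IsConfig.gradSq_box_le {s x : hyperplane N} (hs : IsConfig s) (hx : x ∈ box s) :
    gradSq x ≤ 5 * N := by
  have : (5 : ℝ) * N = ∑ _i : ZMod N, (5 : ℝ) := by simp [ZMod.card, mul_comm]
  rw [gradSq, this]
  refine Finset.sum_le_sum fun i _ => ?_
  have hb : ∀ i, |x.1 i| ≤ 11 / 10 := fun i => by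
    have h := (hs.mul_mem_box hx i)
    rw [abs_le]
    rcases hs i with h' | h' <;> rw [h'] at h <;> constructor <;> linarith [h.1, h.2]
  have h1 := abs_le.1 (hb i)
  have h2 := abs_le.1 (hb (i + 1))
  nlinarith [h1.1, h1.2, h2.1, h2.2]

/-- Combine quadratic growth at coupling γ with minimality at coupling γ'. Only (γ − γ')/4 times a
bounded difference of `gradSq` survives, which gives Hölder-1/2 continuity. -/
theorem IsConfig.sum_sq_branch_sub_le {s : hyperplane N} (hs : IsConfig s) {γ γ' : ℝ}
    (hγ : 0 ≤ γ) (hγ1 : γ * N < 1 / 200) :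
    ∑ i, ((branch s γ').1 i - (branch s γ).1 i) ^ 2 ≤ 5 * N * |γ - γ'| := by
  have h1 := hs.quadratic_growth_box hγ (branch_mem s γ) (branch_mem s γ')
    (hs.isStationary_branch hγ hγ1)
  have h2 : V N γ' (branch s γ') ≤ V N γ' (branch s γ) := branch_isMinOn s γ' (branch_mem s γ)
  rw [MassAC.V_eq, MassAC.V_eq] at h1 h2
  have h3 := hs.gradSq_box_le (branch_mem s γ)
  have h4 := hs.gradSq_box_le (branch_mem s γ')
  have h5 := gradSq_nonneg (branch s γ)
  have h6 := gradSq_nonneg (branch s γ')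
  have h7 : |gradSq (branch s γ') - gradSq (branch s γ)| ≤ 5 * N := by
    rw [abs_le]; constructor <;> linarith
  have h8 : (γ - γ') * (gradSq (branch s γ') - gradSq (branch s γ)) ≤ |γ - γ'| * (5 * N) :=
    (le_abs_self _).trans (by
      rw [abs_mul]; exact mul_le_mul_of_nonneg_left h7 (abs_nonneg _))
  have h9 : 0 ≤ |γ - γ'| * (5 * N) := by positivity
  linarith

theorem IsConfig.continuousOn_branch {s : hyperplane N} (hs : IsConfig s) {γ₀ : ℝ}
    (hγ₀ : γ₀ * N ≤ 1 / 200) : ContinuousOn (branch s) (Set.Ico 0 γ₀) := by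
  intro γ hγ
  have hN : (0 : ℝ) < N := by exact_mod_cast Nat.pos_of_ne_zero (NeZero.ne N)
  have hγ1 : γ * N < 1 / 200 := lt_of_lt_of_le (mul_lt_mul_of_pos_right hγ.2 hN) hγ₀
  refine ContinuousAt.continuousWithinAt ?_
  rw [ContinuousAt, tendsto_iff_dist_tendsto_zero]
  have hlim : Filter.Tendsto (fun γ' : ℝ => √(5 * N * |γ - γ'|)) (nhds γ) (nhds 0) := by
    have : Continuous fun γ' : ℝ => √(5 * N * |γ - γ'|) := by fun_prop
    simpa using this.tendsto γ
  refine squeeze_zero (fun _ => dist_nonneg) (fun γ' => ?_) hlim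
  rw [Subtype.dist_eq, EuclideanSpace.dist_eq]
  refine Real.sqrt_le_sqrt ?_
  simp only [Real.dist_eq, sq_abs]
  exact hs.sum_sq_branch_sub_le hγ.1 hγ1

theorem IsConfig.isContinuation_branch {s : hyperplane N} (hs : IsConfig s) {γ₀ : ℝ}
    (hγ₀ : γ₀ * N ≤ 1 / 200) : IsContinuation γ₀ s (branch s) where
  zero := hs.branch_zero
  continuousOn := hs.continuousOn_branch hγ₀
  isStationary := fun γ hγ => hs.isStationary_branch hγ.1 (lt_of_lt_of_le
    (mul_lt_mul_of_pos_right hγ.2 (by exact_mod_cast Nat.pos_of_ne_zero (NeZero.ne N))) hγ₀)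

/-- The agreement set is clopen in [0, γ₀): it is closed by continuity, and by uniqueness of
stationary points in the box it is the preimage of the open box. -/
theorem IsConfig.continuation_unique {s : hyperplane N} (hs : IsConfig s) {γ₀ : ℝ}
    (hγ₀ : γ₀ * N ≤ 1 / 200) {c : ℝ → hyperplane N} (hc : IsContinuation γ₀ s c) :
    Set.EqOn c (branch s) (Set.Ico 0 γ₀) := by
  have hN : (0 : ℝ) < N := by exact_mod_cast Nat.pos_of_ne_zero (NeZero.ne N)
  set I : Set ℝ := Set.Ico 0 γ₀
  have hb := hs.isContinuation_branch hγ₀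
  have hlt : ∀ γ : I, γ.1 * N < 1 / 200 := fun γ =>
    lt_of_lt_of_le (mul_lt_mul_of_pos_right γ.2.2 hN) hγ₀
  have c1 : Continuous fun γ : I => c γ := hc.continuousOn.domRestrict
  have c2 : Continuous fun γ : I => branch s γ := hb.continuousOn.domRestrict
  have hset : {γ : I | c γ = branch s γ} =
      (fun γ : I => c γ) ⁻¹' {x | ∀ i, |x.1 i - s.1 i| < 1 / 10} := by
    ext γ
    simp only [Set.mem_ofPred_eq, Set.mem_preimage]
    constructor
    · intro h
      rw [h]
      exact hs.abs_branch_sub_lt γ.2.1 (hlt γ)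
    · intro h
      exact hs.stationary_unique γ.2.1 (branch_mem s γ) (fun i => (h i).le)
        (hb.isStationary γ γ.2) (hc.isStationary γ γ.2)
  have hclosed : IsClosed {γ : I | c γ = branch s γ} := isClosed_eq c1 c2
  have hopen : IsOpen {γ : I | c γ = branch s γ} := by
    rw [hset]
    refine IsOpen.preimage c1 ?_
    rw [Set.ofPred_forall]
    exact isOpen_iInter_of_finite fun i => isOpen_lt (by fun_prop) continuous_const
  intro γ hγ
  have : PreconnectedSpace I := Subtype.preconnectedSpace isPreconnected_Ico
  have h0 : (0 : ℝ) ∈ I := ⟨le_rfl, hγ.1.trans_lt hγ.2⟩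
  have huniv := IsClopen.eq_univ ⟨hclosed, hopen⟩ ⟨⟨0, h0⟩, by
    simp [hc.zero, hs.branch_zero]⟩
  exact (huniv ▸ Set.mem_univ (⟨γ, hγ⟩ : I) : (⟨γ, hγ⟩ : I) ∈ {γ : I | c γ = branch s γ})

theorem branch_injOn {γ : ℝ} : Set.InjOn (fun s : hyperplane N => branch s γ) {s | IsConfig s} := by
  intro s hs s' hs' h
  ext i
  have h1 := (hs.mul_mem_box (branch_mem s γ) i).1
  have h2 := (hs'.mul_mem_box (branch_mem s' γ) i).1
  simp only at h
  rw [← h] at h2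
  rcases hs i with a | a <;> rcases hs' i with b | b <;> rw [a] at h1 <;> rw [b] at h2 <;>
    rw [a, b] <;> linarith

theorem IsConfig.V_branch_ge {s : hyperplane N} (hs : IsConfig s) {γ : ℝ} (hγ : 0 ≤ γ) :
    -(N / 4) + γ * interfaces s - N * (4 * γ ^ 2 / (9 / 10)) ≤ V N γ (branch s γ) := by
  have := V_ge_of_quadratic_growth (x := branch s γ) (z := s) (h := 0) (κ := 9 / 10) (γ := γ)
    (by norm_num) hγ (fun k => by rw [hs.abs]; norm_num)
    (by rw [zero_add]; exact hs.excess_ge (branch_mem s γ))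
  rw [hs.gradSq_eq] at this
  linarith

/-! ### Saddles and transition paths -/

/-- For a configuration, there are as many sites like `i` as unlike `i`. -/
theorem IsConfig.sum_three {s : hyperplane N} (hs : IsConfig s) (i : ZMod N) (a b c : ℝ) :
    ∑ k, (if k = i then a else if s.1 k = s.1 i then b else c)
      = a + ((N : ℝ) / 2 - 1) * b + N / 2 * c := by
  have h : ∀ k, (if k = i then a else if s.1 k = s.1 i then b else c)
      = (b + c) / 2 + (b - c) / 2 * s.1 i * s.1 k + if k = i then a - b else 0 := by
    intro k
    have h1 := hs.sq i
    by_cases hk : k = i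
    · subst hk; simp; linear_combination -((b - c) / 2) * h1
    · by_cases hki : s.1 k = s.1 i
      · simp [hk, hki]; linear_combination -((b - c) / 2) * h1
      · rw [hs.eq_neg (Ne.symm hki)]
        simp [hk, (hs.ne_neg i).symm]
        linear_combination (b - c) / 2 * h1
  rw [Finset.sum_congr rfl fun k _ => h k, Finset.sum_add_distrib, Finset.sum_add_distrib,
    ← Finset.mul_sum, sum_eq_zero]
  simp [ZMod.card]
  ring

/-- The point with value `s i * a` at `i`, value `s i * b` at the other sites like `i`, and value
`s i * c` at the sites unlike `i`. -/
def tri (s : hyperplane N) (hs : IsConfig s) (i : ZMod N) (a b c : ℝ)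
    (h : a + ((N : ℝ) / 2 - 1) * b + N / 2 * c = 0) : hyperplane N :=
  ⟨WithLp.toLp 2 fun k => s.1 i * (if k = i then a else if s.1 k = s.1 i then b else c), by
    change ∑ k, s.1 i * (if k = i then a else if s.1 k = s.1 i then b else c) = 0
    rw [← Finset.mul_sum, hs.sum_three, h, mul_zero]⟩

theorem tri_apply {s : hyperplane N} (hs : IsConfig s) (i : ZMod N) {a b c : ℝ}
    (h : a + ((N : ℝ) / 2 - 1) * b + N / 2 * c = 0) (k : ZMod N) :
    (tri s hs i a b c h).1 k
      = s.1 i * (if k = i then a else if s.1 k = s.1 i then b else c) := rfl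

theorem IsConfig.sum_comp_three {s : hyperplane N} (hs : IsConfig s) (i : ZMod N) (a b c : ℝ)
    {x : hyperplane N}
    (hx : ∀ k, x.1 k = s.1 i * (if k = i then a else if s.1 k = s.1 i then b else c)) :
    excess x = (a ^ 2 - 1) ^ 2 / 4 + ((N : ℝ) / 2 - 1) * ((b ^ 2 - 1) ^ 2 / 4)
      + N / 2 * ((c ^ 2 - 1) ^ 2 / 4) := by
  rw [← hs.sum_three i, excess]
  refine Finset.sum_congr rfl fun k _ => ?_
  rw [hx, mul_pow, hs.sq, one_mul]
  split_ifs <;> rfl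

/-- The number of neighbours of `i` that are unlike `i`. -/
def unlike (s : hyperplane N) (i : ZMod N) : ℝ := 1 - s.1 i * (s.1 (i - 1) + s.1 (i + 1)) / 2

theorem add_one_ne_self (hN : 2 ≤ N) (i : ZMod N) : i + 1 ≠ i := by
  have : Fact (1 < N) := ⟨hN⟩
  simp

/-- I − D interfaces do not touch i and carry (b − c)²; the two bonds at i carry (a − c)² or (a −
b)² according to the neighbour. The proof writes the point, up to the sign s_i, as an affine
function of s plus a spike at i. -/
theorem gradSq_tri (hN : 2 ≤ N) {s : hyperplane N} (hs : IsConfig s) (i : ZMod N) {a b c : ℝ}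
    (h : a + ((N : ℝ) / 2 - 1) * b + N / 2 * c = 0) :
    gradSq (tri s hs i a b c h) = (b - c) ^ 2 * (interfaces s - unlike s i)
      + unlike s i * (a - c) ^ 2 + (2 - unlike s i) * (a - b) ^ 2 := by
  set y : ZMod N → ℝ := fun k => (b + c) / 2 + (b - c) / 2 * (s.1 i * s.1 k) with hy
  set e : ZMod N → ℝ := fun k => if k = i then 1 else 0 with he
  have hx : ∀ k, (tri s hs i a b c h).1 k = s.1 i * (y k + (a - b) * e k) := by
    intro k
    rw [tri_apply, hy, he]
    congr 1
    have h1 := hs.sq i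
    by_cases hk : k = i
    · subst hk; simp; linear_combination -((b - c) / 2) * h1
    · by_cases hki : s.1 k = s.1 i
      · simp [hk, hki]; linear_combination -((b - c) / 2) * h1
      · have h2 := hs.eq_neg (Ne.symm hki)
        simp only [hk, hki, if_false]
        linear_combination -((b - c) / 2) * s.1 i * h2 + (b - c) / 2 * h1
  have hterm : ∀ k, ((tri s hs i a b c h).1 (k + 1) - (tri s hs i a b c h).1 k) ^ 2
      = (b - c) ^ 2 / 4 * (s.1 (k + 1) - s.1 k) ^ 2
        + (2 * (a - b) * (y (k + 1) - y k) * e (k + 1) + (a - b) ^ 2 * e (k + 1))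
        + (-(2 * (a - b) * (y (k + 1) - y k)) * e k + (a - b) ^ 2 * e k) := by
    intro k
    rw [hx, hx]
    have h1 : e (k + 1) * e k = 0 := by
      simp only [he]
      by_cases hk : k = i
      · subst hk; simp [add_one_ne_self hN]
      · simp [hk]
    have h2 : ∀ k, e k ^ 2 = e k := fun k => by simp only [he]; split_ifs <;> norm_num
    have h3 := h2 k
    have h4 := h2 (k + 1)
    have h5 := hs.sq i
    have h6 : y (k + 1) - y k = (b - c) / 2 * s.1 i * (s.1 (k + 1) - s.1 k) := by
      simp only [hy]; ring
    have h7 : (y (k + 1) - y k) ^ 2 = (b - c) ^ 2 / 4 * (s.1 (k + 1) - s.1 k) ^ 2 := by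
      rw [h6]; linear_combination (b - c) ^ 2 / 4 * (s.1 (k + 1) - s.1 k) ^ 2 * h5
    linear_combination (y (k + 1) + (a - b) * e (k + 1) - (y k + (a - b) * e k)) ^ 2 * h5 + h7
      + (a - b) ^ 2 * h3 + (a - b) ^ 2 * h4 - 2 * (a - b) ^ 2 * h1
  have s1 : ∑ k, (2 * (a - b) * (y (k + 1) - y k) * e (k + 1) + (a - b) ^ 2 * e (k + 1))
      = 2 * (a - b) * (y i - y (i - 1)) + (a - b) ^ 2 := by
    have := sum_shift fun k => (2 * (a - b) * (y k - y (k - 1)) + (a - b) ^ 2) * e k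
    simp only [add_sub_cancel_right] at this
    refine (Finset.sum_congr rfl fun k _ => ?_).trans (this.trans ?_)
    · ring
    · simp [he]
  have s2 : ∑ k, (-(2 * (a - b) * (y (k + 1) - y k)) * e k + (a - b) ^ 2 * e k)
      = -(2 * (a - b) * (y (i + 1) - y i)) + (a - b) ^ 2 := by
    have : ∀ k, -(2 * (a - b) * (y (k + 1) - y k)) * e k + (a - b) ^ 2 * e k
        = (-(2 * (a - b) * (y (k + 1) - y k)) + (a - b) ^ 2) * e k := fun k => by ring
    rw [Finset.sum_congr rfl fun k _ => this k]
    simp [he]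
  rw [gradSq, Finset.sum_congr rfl fun k _ => hterm k, Finset.sum_add_distrib,
    Finset.sum_add_distrib, s1, s2, ← Finset.mul_sum, ← gradSq, hs.gradSq_eq]
  have h1 := hs.sq i
  simp only [hy, unlike]
  linear_combination 2 * (a - b) * (b - c) * h1

/-- Coordinates of the points of the segment from `z` to `w`. -/
theorem lineMap_apply_coord (z w : hyperplane N) (θ : ℝ) (k : ZMod N) :
    (AffineMap.lineMap z w θ : hyperplane N).1 k = z.1 k + θ * (w.1 k - z.1 k) := by
  rw [AffineMap.lineMap_apply]
  simp
  ring

/-- A segment along which the uncoupled energy decreases quadratically stays, at weak coupling,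
below the energy of its starting point up to a small fraction of the coupling. -/
theorem eventually_joinedIn_segment {z w : hyperplane N} {h κ η : ℝ} (hκ : 0 < κ) (hη : 0 < η)
    (hx : ∀ θ ∈ Set.Icc (0 : ℝ) 1, excess (AffineMap.lineMap z w θ : hyperplane N)
      ≤ h - κ * θ ^ 2) :
    ∀ᶠ γ in nhdsWithin (0 : ℝ) (Set.Ioi 0),
      JoinedIn {x | V N γ x ≤ h - N / 4 + γ * (gradSq z / 4 + η)} z w := by
  obtain ⟨C, hC0, hC⟩ : ∃ C : ℝ, 0 ≤ C ∧ ∀ θ ∈ Set.Icc (0 : ℝ) 1,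
      gradSq (AffineMap.lineMap z w θ : hyperplane N) ≤ gradSq z + C * θ := by
    refine ⟨2 * |∑ k, (z.1 (k + 1) - z.1 k) * ((w - z).1 (k + 1) - (w - z).1 k)|
      + gradSq (w - z), by have := gradSq_nonneg (w - z); positivity, fun θ hθ => ?_⟩
    have e : gradSq (AffineMap.lineMap z w θ : hyperplane N) = gradSq z
        + 2 * θ * ∑ k, (z.1 (k + 1) - z.1 k) * ((w - z).1 (k + 1) - (w - z).1 k)
        + θ ^ 2 * gradSq (w - z) := by
      rw [gradSq, gradSq, gradSq, Finset.mul_sum, Finset.mul_sum, ← Finset.sum_add_distrib,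
        ← Finset.sum_add_distrib]
      refine Finset.sum_congr rfl fun k _ => ?_
      rw [lineMap_apply_coord, lineMap_apply_coord]
      simp only [Submodule.coe_sub, PiLp.sub_apply]
      ring
    rw [e]
    have h1 := le_abs_self (∑ k, (z.1 (k + 1) - z.1 k) * ((w - z).1 (k + 1) - (w - z).1 k))
    have h2 := gradSq_nonneg (w - z)
    have h3 : θ ^ 2 ≤ θ := by nlinarith [hθ.1, hθ.2]
    nlinarith [mul_le_mul_of_nonneg_left h1 hθ.1, mul_le_mul_of_nonneg_right h3 h2]
  -- The maximum over θ of γCθ/4 − κθ² is γ²C²/(64κ), which must stay below γη.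
  have hev : ∀ᶠ γ in nhdsWithin (0 : ℝ) (Set.Ioi 0), γ * C ^ 2 < 64 * κ * η := by
    have : Filter.Tendsto (fun γ : ℝ => γ * C ^ 2) (nhds 0) (nhds 0) := by
      have : Continuous fun γ : ℝ => γ * C ^ 2 := by fun_prop
      simpa using this.tendsto 0
    exact (this.eventually (gt_mem_nhds (by positivity))).filter_mono nhdsWithin_le_nhds
  filter_upwards [hev, self_mem_nhdsWithin] with γ hγ hγ0
  have hγ0 : 0 < γ := hγ0
  refine JoinedIn.ofLine (f := fun θ : ℝ => (AffineMap.lineMap z w θ : hyperplane N))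
    AffineMap.lineMap_continuous.continuousOn (by simp) (by simp) ?_
  rintro _ ⟨θ, hθ, rfl⟩
  have h1 := hx θ hθ
  have h2 := hC θ hθ
  change V N γ _ ≤ _
  rw [V_eq]
  have h3 : γ / 4 * (C * θ) ≤ κ * θ ^ 2 + γ * η := by
    have e1 : 0 ≤ (8 * κ * θ - γ * C) ^ 2 := sq_nonneg _
    have e2 : γ * (γ * C ^ 2) ≤ γ * (64 * κ * η) := mul_le_mul_of_nonneg_left hγ.le hγ0.le
    have : 0 ≤ 64 * κ * (κ * θ ^ 2 + γ * η - γ / 4 * (C * θ)) := by nlinarith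
    have := nonneg_of_mul_nonneg_right this (by positivity)
    linarith
  nlinarith [mul_le_mul_of_nonneg_left h2 (div_nonneg hγ0.le (by norm_num : (0 : ℝ) ≤ 4))]

/-- As q4 ≥ 0, the bracket is convex in θ, so it lies below the chord joining its negative values q2
at θ = 0 and q2 + q3 + q4 at θ = 1. -/
theorem exists_quadratic_bound {q2 q3 q4 : ℝ} (h2 : q2 < 0) (h4 : 0 ≤ q4)
    (h1 : q2 + q3 + q4 < 0) :
    ∃ κ : ℝ, 0 < κ ∧ ∀ θ ∈ Set.Icc (0 : ℝ) 1,
      θ ^ 2 * (q2 + q3 * θ + q4 * θ ^ 2) ≤ -(κ * θ ^ 2) := by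
  refine ⟨min (-q2) (-(q2 + q3 + q4)), lt_min (by linarith) (by linarith), fun θ hθ => ?_⟩
  have h3 := min_le_left (-q2) (-(q2 + q3 + q4))
  have h5 := min_le_right (-q2) (-(q2 + q3 + q4))
  generalize min (-q2) (-(q2 + q3 + q4)) = κ at *
  have e1 : q4 * θ ^ 2 ≤ q4 * θ := mul_le_mul_of_nonneg_left (by nlinarith [hθ.1, hθ.2]) h4
  have e2 := mul_le_mul_of_nonneg_left h3 (sub_nonneg.2 hθ.2)
  have e3 := mul_le_mul_of_nonneg_left h5 hθ.1
  have e4 : q2 + q3 * θ + q4 * θ ^ 2 ≤ -κ := by linarith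
  have e5 := mul_le_mul_of_nonneg_left e4 (sq_nonneg θ)
  linarith

/-- A weighted sum of three double-well energies along a segment leaving a critical point. -/
theorem exists_quadratic_decrease {m a b c u v w lam h : ℝ} (hm : 1 ≤ m)
    (ha : a ^ 3 - a = lam) (hb : b ^ 3 - b = lam) (hc : c ^ 3 - c = lam)
    (h0 : u + (m - 1) * v + m * w = 0)
    (hh : (a ^ 2 - 1) ^ 2 / 4 + (m - 1) * ((b ^ 2 - 1) ^ 2 / 4) + m * ((c ^ 2 - 1) ^ 2 / 4) = h)
    (hh' : ((a + u) ^ 2 - 1) ^ 2 / 4 + (m - 1) * (((b + v) ^ 2 - 1) ^ 2 / 4)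
      + m * (((c + w) ^ 2 - 1) ^ 2 / 4) < h)
    (hQ : (3 * a ^ 2 - 1) * u ^ 2 + (m - 1) * ((3 * b ^ 2 - 1) * v ^ 2)
      + m * ((3 * c ^ 2 - 1) * w ^ 2) < 0) :
    ∃ κ : ℝ, 0 < κ ∧ ∀ θ ∈ Set.Icc (0 : ℝ) 1,
      ((a + θ * u) ^ 2 - 1) ^ 2 / 4 + (m - 1) * (((b + θ * v) ^ 2 - 1) ^ 2 / 4)
        + m * (((c + θ * w) ^ 2 - 1) ^ 2 / 4) ≤ h - κ * θ ^ 2 := by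
  obtain ⟨q2, hq2⟩ : ∃ q2, q2 = ((3 * a ^ 2 - 1) * u ^ 2 + (m - 1) * ((3 * b ^ 2 - 1) * v ^ 2)
      + m * ((3 * c ^ 2 - 1) * w ^ 2)) / 2 := ⟨_, rfl⟩
  obtain ⟨q3, hq3⟩ : ∃ q3, q3 = a * u ^ 3 + (m - 1) * (b * v ^ 3) + m * (c * w ^ 3) := ⟨_, rfl⟩
  obtain ⟨q4, hq4⟩ : ∃ q4, q4 = (u ^ 4 + (m - 1) * v ^ 4 + m * w ^ 4) / 4 := ⟨_, rfl⟩
  have hq4' : 0 ≤ q4 := by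
    have : 0 ≤ m - 1 := by linarith
    rw [hq4]; positivity
  have key : ∀ θ : ℝ, ((a + θ * u) ^ 2 - 1) ^ 2 / 4 + (m - 1) * (((b + θ * v) ^ 2 - 1) ^ 2 / 4)
      + m * (((c + θ * w) ^ 2 - 1) ^ 2 / 4) = h + θ ^ 2 * (q2 + q3 * θ + q4 * θ ^ 2) := by
    intro θ
    rw [← hh, hq2, hq3, hq4]
    -- The linear coefficient vanishes: all three values solve the same cubic, so it equals λ(u +
    -- (m−1)v + mw) = 0.
    linear_combination θ * lam * h0 + θ * u * ha + θ * (m - 1) * v * hb + θ * m * w * hc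
  have h1 : q2 + q3 + q4 < 0 := by
    have := key 1
    simp only [one_mul] at this
    rw [this] at hh'
    linarith
  obtain ⟨κ, hκ, H⟩ := exists_quadratic_bound (by rw [hq2]; linarith) hq4' h1
  refine ⟨κ, hκ, fun θ hθ => ?_⟩
  rw [key]
  have := H θ hθ
  linarith

variable (N) in
/-- The square of the inverse of the central root at the saddles. -/
def invSq : ℝ := ((N : ℝ) / 2) ^ 2 - 3 * (N / 2) + 3

variable (N) in
/-- The absolute value of the coordinate that is at the central root, at a saddle. -/
def thr : ℝ := (√(invSq N))⁻¹

variable (N) in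
/-- The uncoupled energy of the saddles, above the minimum. -/
def height : ℝ := (N : ℝ) / 2 * (N / 2 - 1) / (4 * invSq N)

variable (N) in
/-- The first-order energy of a saddle: `I` interfaces, and `D` unlike neighbours of the site that
is at the central root. -/
def lev (I D : ℝ) : ℝ :=
  ((2 * ((N : ℝ) / 2) - 3) ^ 2 * (I - D) + D * (N / 2 - 3) ^ 2 + (2 - D) * (N / 2) ^ 2)
    / (4 * invSq N)

/-! ### Arithmetic of the saddles and valleys -/

theorem invSq_ge (hN : 8 ≤ N) : 7 ≤ invSq N := by
  have : (8 : ℝ) ≤ N := by exact_mod_cast hN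
  unfold invSq; nlinarith

theorem thr_pos (hN : 8 ≤ N) : 0 < thr N := by
  have := invSq_ge hN
  unfold thr; positivity

theorem thr_sq (hN : 8 ≤ N) : thr N ^ 2 * invSq N = 1 := by
  have := invSq_ge hN
  rw [thr, inv_pow, Real.sq_sqrt (by linarith)]
  field_simp

theorem thr_sq_le (hN : 8 ≤ N) : thr N ^ 2 ≤ 1 / 7 := by
  have h1 := invSq_ge hN
  have h2 := thr_sq hN
  nlinarith [sq_nonneg (thr N)]

theorem height_eq (hN : 8 ≤ N) :
    height N = thr N ^ 2 * ((N : ℝ) / 2 * (N / 2 - 1)) / 4 := by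
  have h1 := invSq_ge hN
  rw [height]
  field_simp
  linear_combination (-((N : ℝ) - 2)) * thr_sq hN

theorem height_pos (hN : 8 ≤ N) : 0 < height N := by
  have h1 := invSq_ge hN
  have : (8 : ℝ) ≤ N := by exact_mod_cast hN
  have : (0 : ℝ) < N / 2 - 1 := by linarith
  unfold height; positivity

theorem saddle_balance (m t : ℝ) : -t + (m - 1) * ((m - 1) * t) + m * (-((m - 2) * t)) = 0 := by
  ring

/-- The saddle through which the site `i` of `s` changes sign. -/
def saddle (s : hyperplane N) (hs : IsConfig s) (i : ZMod N) : hyperplane N :=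
  tri s hs i (-thr N) (((N : ℝ) / 2 - 1) * thr N) (-(((N : ℝ) / 2 - 2) * thr N))
    (saddle_balance _ _)

variable (N) in
/-- The value at the negative sites, for the point `valley`. -/
def valleyRoot : ℝ := ((N : ℝ) / 2 - 1) ^ 2 * thr N / (N / 2 + 1)

theorem valley_balance :
    -valleyRoot N + ((N : ℝ) / 2 - 1) * (((N : ℝ) / 2 - 1) * thr N) + N / 2 * (-valleyRoot N)
      = 0 := by
  have : (N : ℝ) / 2 + 1 ≠ 0 := by positivity
  rw [valleyRoot]
  field_simp
  ring

/-- A point of low energy with one coordinate less of the sign of `s i` than `s`. -/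
def valley (s : hyperplane N) (hs : IsConfig s) (i : ZMod N) : hyperplane N :=
  tri s hs i (-valleyRoot N) (((N : ℝ) / 2 - 1) * thr N) (-valleyRoot N) valley_balance

/-- The values −t, (m−1)t, −(m−2)t sum to zero, so they are the roots of one ξ³ − ξ = λ as soon as
their pairwise products sum to −1, that is t²(m² − 3m + 3) = 1. This fixes `thr`. -/
theorem saddle_cubic (hN : 8 ≤ N) : (((N : ℝ) / 2 - 1) * thr N) ^ 3 - ((N : ℝ) / 2 - 1) * thr N
      = (-thr N) ^ 3 - (-thr N) ∧
    (-(((N : ℝ) / 2 - 2) * thr N)) ^ 3 - -(((N : ℝ) / 2 - 2) * thr N)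
      = (-thr N) ^ 3 - (-thr N) := by
  have h := thr_sq hN
  unfold invSq at h
  constructor
  · linear_combination (N : ℝ) / 2 * thr N * h
  · linear_combination (-((N : ℝ) / 2 - 3) * thr N) * h

theorem saddle_excess_aux (hN : 8 ≤ N) :
    ((-thr N) ^ 2 - 1) ^ 2 / 4 + ((N : ℝ) / 2 - 1) * (((((N : ℝ) / 2 - 1) * thr N) ^ 2 - 1) ^ 2 / 4)
      + N / 2 * (((-(((N : ℝ) / 2 - 2) * thr N)) ^ 2 - 1) ^ 2 / 4) = height N := by
  rw [height_eq hN]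
  have h := thr_sq hN
  unfold invSq at h
  generalize thr N = t at *
  generalize (N : ℝ) / 2 = m at *
  have e1 : t ^ 2 - 1 = -((m - 1) * (m - 2)) * t ^ 2 := by linear_combination h
  have e2 : ((m - 1) * t) ^ 2 - 1 = (m - 2) * t ^ 2 := by linear_combination h
  have e3 : ((m - 2) * t) ^ 2 - 1 = -(m - 1) * t ^ 2 := by linear_combination h
  rw [neg_sq, neg_sq, e1, e2, e3]
  linear_combination t ^ 2 * m * (m - 1) / 4 * h

theorem excess_saddle (hN : 8 ≤ N) {s : hyperplane N} (hs : IsConfig s) (i : ZMod N) :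
    excess (saddle s hs i) = height N := by
  rw [saddle, hs.sum_comp_three i _ _ _ (tri_apply hs i _)]
  exact saddle_excess_aux hN

theorem gradSq_saddle (hN : 8 ≤ N) {s : hyperplane N} (hs : IsConfig s) (i : ZMod N) :
    gradSq (saddle s hs i) / 4 = lev N (interfaces s) (unlike s i) := by
  have h1 := invSq_ge hN
  have h := thr_sq hN
  rw [saddle, gradSq_tri (by omega), lev, div_eq_div_iff (by norm_num) (by positivity)]
  generalize thr N = t at *
  generalize invSq N = T at *
  generalize unlike s i = D at *
  generalize (interfaces s : ℝ) = I at *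
  generalize (N : ℝ) / 2 = m at *
  linear_combination 4 * ((2 * m - 3) ^ 2 * (I - D) + D * (m - 3) ^ 2 + (2 - D) * m ^ 2) * h

theorem self_apply_tri {s : hyperplane N} (hs : IsConfig s) (i k : ZMod N) :
    s.1 k = s.1 i * (if k = i then 1 else if s.1 k = s.1 i then 1 else -1) := by
  by_cases hk : k = i
  · simp [hk]
  · by_cases hki : s.1 k = s.1 i
    · simp [hki]
    · rw [hs.eq_neg (Ne.symm hki)]
      simp [hk, (hs.ne_neg i).symm]

/-- The valley keeps the m − 1 coordinates (m−1)t of the saddle and replaces the other m + 1 by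
their mean. With t²(m² − 3m + 3) = 1 both sides become multiples of t⁴, and the difference is a
polynomial in m − 4 with positive coefficients. -/
theorem valley_excess_aux (hN : 8 ≤ N) :
    ((-valleyRoot N) ^ 2 - 1) ^ 2 / 4
      + ((N : ℝ) / 2 - 1) * (((((N : ℝ) / 2 - 1) * thr N) ^ 2 - 1) ^ 2 / 4)
      + N / 2 * (((-valleyRoot N) ^ 2 - 1) ^ 2 / 4) < height N := by
  rw [height_eq hN]
  have h := thr_sq hN
  have ht := thr_pos hN
  unfold invSq at h
  have hm : (4 : ℝ) ≤ N / 2 := by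
    have : (8 : ℝ) ≤ N := by exact_mod_cast hN
    linarith
  unfold valleyRoot
  generalize thr N = t at *
  generalize (N : ℝ) / 2 = m at *
  have hm1 : 0 < m + 1 := by linarith
  have e2 : ((m - 1) * t) ^ 2 - 1 = (m - 2) * t ^ 2 := by linear_combination h
  have e3 : (-((m - 1) ^ 2 * t / (m + 1))) ^ 2 - 1
      = -(3 * m ^ 3 - 8 * m ^ 2 + 7 * m + 2) * t ^ 2 / (m + 1) ^ 2 := by
    field_simp
    linear_combination (m + 1) ^ 2 * h
  rw [e2, e3]
  have e4 : (-(3 * m ^ 3 - 8 * m ^ 2 + 7 * m + 2) * t ^ 2 / (m + 1) ^ 2) ^ 2 / 4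
      + (m - 1) * (((m - 2) * t ^ 2) ^ 2 / 4)
      + m * ((-(3 * m ^ 3 - 8 * m ^ 2 + 7 * m + 2) * t ^ 2 / (m + 1) ^ 2) ^ 2 / 4)
      = t ^ 4 * ((3 * m ^ 3 - 8 * m ^ 2 + 7 * m + 2) ^ 2 + (m - 1) * (m - 2) ^ 2 * (m + 1) ^ 3)
        / (4 * (m + 1) ^ 3) := by
    field_simp
    ring
  have e5 : t ^ 2 * (m * (m - 1)) / 4
      = t ^ 4 * (m * (m - 1) * (m ^ 2 - 3 * m + 3) * (m + 1) ^ 3) / (4 * (m + 1) ^ 3) := by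
    field_simp
    linear_combination (-(m - 1)) * h
  rw [e4, e5]
  refine div_lt_div_of_pos_right (mul_lt_mul_of_pos_left ?_ (by positivity)) (by positivity)
  obtain ⟨k, rfl⟩ : ∃ k, m = k + 4 := ⟨m - 4, by ring⟩
  have hk : 0 ≤ k := by linarith
  have : 0 < (k + 4) * (k + 4 - 1) * ((k + 4) ^ 2 - 3 * (k + 4) + 3) * (k + 4 + 1) ^ 3
      - ((3 * (k + 4) ^ 3 - 8 * (k + 4) ^ 2 + 7 * (k + 4) + 2) ^ 2
        + (k + 4 - 1) * (k + 4 - 2) ^ 2 * (k + 4 + 1) ^ 3) := by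
    ring_nf
    positivity
  linarith

theorem valley_curvature_aux (hN : 8 ≤ N) :
    (3 * (-thr N) ^ 2 - 1) * (-valleyRoot N - -thr N) ^ 2
      + ((N : ℝ) / 2 - 1) * ((3 * (((N : ℝ) / 2 - 1) * thr N) ^ 2 - 1)
        * (((N : ℝ) / 2 - 1) * thr N - ((N : ℝ) / 2 - 1) * thr N) ^ 2)
      + N / 2 * ((3 * (-(((N : ℝ) / 2 - 2) * thr N)) ^ 2 - 1)
        * (-valleyRoot N - -(((N : ℝ) / 2 - 2) * thr N)) ^ 2) < 0 := by
  have h := thr_sq hN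
  have ht := thr_pos hN
  unfold invSq at h
  have hm : (4 : ℝ) ≤ N / 2 := by
    have : (8 : ℝ) ≤ N := by exact_mod_cast hN
    linarith
  unfold valleyRoot
  generalize thr N = t at *
  generalize (N : ℝ) / 2 = m at *
  have hm1 : 0 < m + 1 := by linarith
  have hm3 : 0 < m - 3 := by linarith
  have e1 : -((m - 1) ^ 2 * t / (m + 1)) - -t = -(m * (m - 3) * t) / (m + 1) := by
    field_simp; ring
  have e2 : -((m - 1) ^ 2 * t / (m + 1)) - -((m - 2) * t) = (m - 3) * t / (m + 1) := by
    field_simp; ring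
  have e3 : 3 * (-t) ^ 2 - 1 = -(m * (m - 3)) * t ^ 2 := by linear_combination h
  have e4 : 3 * (-((m - 2) * t)) ^ 2 - 1 = (2 * m - 3) * (m - 3) * t ^ 2 := by
    linear_combination h
  rw [e1, e2, e3, e4]
  have : -(m * (m - 3)) * t ^ 2 * (-(m * (m - 3) * t) / (m + 1)) ^ 2
      + (m - 1) * ((3 * ((m - 1) * t) ^ 2 - 1) * ((m - 1) * t - (m - 1) * t) ^ 2)
      + m * ((2 * m - 3) * (m - 3) * t ^ 2 * ((m - 3) * t / (m + 1)) ^ 2)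
      = -(m * (m - 3) ^ 3 * (m ^ 2 - 2 * m + 3) * t ^ 4 / (m + 1) ^ 2) := by
    field_simp
    ring
  rw [this]
  have : 0 < m ^ 2 - 2 * m + 3 := by nlinarith
  have : 0 < m := by linarith
  have : 0 < m * (m - 3) ^ 3 * (m ^ 2 - 2 * m + 3) * t ^ 4 / (m + 1) ^ 2 := by positivity
  linarith

/-- In units of t, the configuration has coordinates ±r with r = 1/t between m − 3/2 and m − 1. So
the outer coordinates move by at most 1/2 and 1, while the central one, in the concave region, moves
by r + 1 and dominates. -/
theorem config_curvature_aux (hN : 8 ≤ N) :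
    (3 * (-thr N) ^ 2 - 1) * (1 - -thr N) ^ 2
      + ((N : ℝ) / 2 - 1) * ((3 * (((N : ℝ) / 2 - 1) * thr N) ^ 2 - 1)
        * (1 - ((N : ℝ) / 2 - 1) * thr N) ^ 2)
      + N / 2 * ((3 * (-(((N : ℝ) / 2 - 2) * thr N)) ^ 2 - 1)
        * (-1 - -(((N : ℝ) / 2 - 2) * thr N)) ^ 2) < 0 := by
  have h := thr_sq hN
  have ht := thr_pos hN
  unfold invSq at h
  have hm : (4 : ℝ) ≤ N / 2 := by
    have : (8 : ℝ) ≤ N := by exact_mod_cast hN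
    linarith
  generalize thr N = t at *
  generalize (N : ℝ) / 2 = m at *
  obtain ⟨r, hr⟩ : ∃ r, r = t⁻¹ := ⟨_, rfl⟩
  have hr0 : 0 < r := by rw [hr]; positivity
  have hrt : r * t = 1 := by rw [hr]; field_simp
  have hr2 : r ^ 2 = m ^ 2 - 3 * m + 3 := by
    linear_combination (-(r ^ 2)) * h + (m ^ 2 - 3 * m + 3) * (r * t + 1) * hrt
  have hrl : m - 3 / 2 ≤ r := by
    rw [← pow_le_pow_iff_left₀ (by linarith) hr0.le two_ne_zero, hr2]
    linarith
  have hru : r ≤ m - 1 := by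
    rw [← pow_le_pow_iff_left₀ hr0.le (by linarith) two_ne_zero, hr2]
    linarith
  have e0 : 3 * (-t) ^ 2 - 1 = -(m * (m - 3)) * t ^ 2 := by linear_combination h
  have e1 : 3 * ((m - 1) * t) ^ 2 - 1 = m * (2 * m - 3) * t ^ 2 := by linear_combination h
  have e2 : 3 * (-((m - 2) * t)) ^ 2 - 1 = (2 * m - 3) * (m - 3) * t ^ 2 := by
    linear_combination h
  have e3 : 1 - -t = t * (r + 1) := by linear_combination -hrt
  have e4 : 1 - (m - 1) * t = t * (r - (m - 1)) := by linear_combination -hrt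
  have e5 : -1 - -((m - 2) * t) = t * ((m - 2) - r) := by linear_combination hrt
  rw [e0, e1, e2, e3, e4, e5]
  have : -(m * (m - 3)) * t ^ 2 * (t * (r + 1)) ^ 2
      + (m - 1) * (m * (2 * m - 3) * t ^ 2 * (t * (r - (m - 1))) ^ 2)
      + m * ((2 * m - 3) * (m - 3) * t ^ 2 * (t * ((m - 2) - r)) ^ 2)
      = -(m * t ^ 4 * ((m - 3) * (r + 1) ^ 2 - (m - 1) * (2 * m - 3) * (m - 1 - r) ^ 2
        - (2 * m - 3) * (m - 3) * (r - (m - 2)) ^ 2)) := by ring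
  rw [this]
  have h1 : (m - 1 / 2) ^ 2 ≤ (r + 1) ^ 2 :=
    pow_le_pow_left₀ (by linarith) (by linarith) 2
  have h2 : (m - 1 - r) ^ 2 ≤ (1 / 2) ^ 2 :=
    pow_le_pow_left₀ (by linarith) (by linarith) 2
  have h3 : (r - (m - 2)) ^ 2 ≤ 1 ^ 2 :=
    pow_le_pow_left₀ (by linarith) (by linarith) 2
  have h4 := mul_le_mul_of_nonneg_left h1 (by linarith : 0 ≤ m - 3)
  have h5 := mul_le_mul_of_nonneg_left h2
    (mul_nonneg (by linarith : 0 ≤ m - 1) (by linarith : 0 ≤ 2 * m - 3))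
  have h6 := mul_le_mul_of_nonneg_left h3
    (mul_nonneg (by linarith : 0 ≤ 2 * m - 3) (by linarith : 0 ≤ m - 3))
  have h7 : 0 < (m - 3) * (m - 1 / 2) ^ 2 - (m - 1) * (2 * m - 3) * (1 / 2) ^ 2
      - (2 * m - 3) * (m - 3) * 1 ^ 2 := by
    obtain ⟨k, rfl⟩ : ∃ k, m = k + 4 := ⟨m - 4, by ring⟩
    have hk : 0 ≤ k := by linarith
    ring_nf
    positivity
  have h8 : 0 < (m - 3) * (r + 1) ^ 2 - (m - 1) * (2 * m - 3) * (m - 1 - r) ^ 2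
        - (2 * m - 3) * (m - 3) * (r - (m - 2)) ^ 2 := by linarith
  have : 0 < m := by linarith
  have : 0 < m * t ^ 4 * ((m - 3) * (r + 1) ^ 2 - (m - 1) * (2 * m - 3) * (m - 1 - r) ^ 2
        - (2 * m - 3) * (m - 3) * (r - (m - 2)) ^ 2) := by positivity
  linarith

/-- Along the segment from the saddle the uncoupled energy has no linear term, starts with negative
curvature and ends below `height N`, so it decreases quadratically. The coupling then contributes
essentially its value at the saddle. -/
theorem eventually_joinedIn_saddle (hN : 8 ≤ N) {s : hyperplane N} (hs : IsConfig s) (i : ZMod N)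
    {η : ℝ} (hη : 0 < η) {w : hyperplane N} {a b c : ℝ}
    (hw : ∀ k, w.1 k = s.1 i * (if k = i then a else if s.1 k = s.1 i then b else c))
    (hbal : a + ((N : ℝ) / 2 - 1) * b + N / 2 * c = 0)
    (hh' : (a ^ 2 - 1) ^ 2 / 4 + ((N : ℝ) / 2 - 1) * ((b ^ 2 - 1) ^ 2 / 4)
      + N / 2 * ((c ^ 2 - 1) ^ 2 / 4) < height N)
    (hQ : (3 * (-thr N) ^ 2 - 1) * (a - -thr N) ^ 2
      + ((N : ℝ) / 2 - 1) * ((3 * (((N : ℝ) / 2 - 1) * thr N) ^ 2 - 1)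
        * (b - ((N : ℝ) / 2 - 1) * thr N) ^ 2)
      + N / 2 * ((3 * (-(((N : ℝ) / 2 - 2) * thr N)) ^ 2 - 1)
        * (c - -(((N : ℝ) / 2 - 2) * thr N)) ^ 2) < 0) :
    ∀ᶠ γ in nhdsWithin (0 : ℝ) (Set.Ioi 0),
      JoinedIn {x | V N γ x ≤ height N - N / 4 + γ * (lev N (interfaces s) (unlike s i) + η)}
        (saddle s hs i) w := by
  have hm : (1 : ℝ) ≤ N / 2 := by
    have : (8 : ℝ) ≤ N := by exact_mod_cast hN
    linarith
  obtain ⟨κ, hκ, H⟩ := exists_quadratic_decrease (m := (N : ℝ) / 2) hm rfl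
    (saddle_cubic hN).1 (saddle_cubic hN).2
    (by linear_combination hbal - saddle_balance ((N : ℝ) / 2) (thr N))
    (saddle_excess_aux hN) (by simpa only [add_sub_cancel] using hh') hQ
  rw [← gradSq_saddle hN hs]
  refine eventually_joinedIn_segment hκ hη fun θ hθ => ?_
  refine le_trans (le_of_eq ?_) (H θ hθ)
  refine hs.sum_comp_three i _ _ _ fun k => ?_
  rw [lineMap_apply_coord, hw, saddle, tri_apply]
  split_ifs <;> ring

/-- Flipping the sign of one site. -/
theorem eventually_joinedIn_valley (hN : 8 ≤ N) {s : hyperplane N} (hs : IsConfig s) (i : ZMod N)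
    {η : ℝ} (hη : 0 < η) :
    ∀ᶠ γ in nhdsWithin (0 : ℝ) (Set.Ioi 0),
      JoinedIn {x | V N γ x ≤ height N - N / 4 + γ * (lev N (interfaces s) (unlike s i) + η)}
        s (valley s hs i) := by
  have h1 := eventually_joinedIn_saddle hN hs i hη (self_apply_tri hs i) (by ring)
    (by norm_num; exact height_pos hN) (config_curvature_aux hN)
  have h2 := eventually_joinedIn_saddle hN hs i hη (tri_apply hs i valley_balance) valley_balance
    (valley_excess_aux hN) (valley_curvature_aux hN)
  filter_upwards [h1, h2] with γ h1 h2
  exact h1.symm.trans h2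

/-- A valley depends only on the m − 1 sites that keep the sign of s_i, and these are the same for s
without i as for s' without j. Thus the two saddles of an exchange lead to one valley. -/
theorem valley_eq_valley {s s' : hyperplane N} (hs : IsConfig s) (hs' : IsConfig s')
    {i j : ZMod N} (hij : s.1 j = -s.1 i) (hi : s'.1 i = -s.1 i) (hj : s'.1 j = s.1 i)
    (hk : ∀ k, k ≠ i → k ≠ j → s'.1 k = s.1 k) : valley s hs i = valley s' hs' j := by
  ext k
  rw [valley, valley, tri_apply, tri_apply, hj]
  congr 1
  have hne := hs.ne_neg i
  by_cases h1 : k = i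
  · subst h1
    have : k ≠ j := fun h => hne (h ▸ hij)
    simp [this, hi, hne.symm]
  · by_cases h2 : k = j
    · subst h2
      simp [h1, hij, hne.symm]
    · simp [h1, h2, hk k h1 h2]

/-- Exchanging a particle and a hole. -/
theorem eventually_joinedIn_exchange (hN : 8 ≤ N) {s s' : hyperplane N} (hs : IsConfig s)
    (hs' : IsConfig s') {i j : ZMod N} (hij : s.1 j = -s.1 i) (hi : s'.1 i = -s.1 i)
    (hj : s'.1 j = s.1 i) (hk : ∀ k, k ≠ i → k ≠ j → s'.1 k = s.1 k) {L η : ℝ} (hη : 0 < η)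
    (h1 : lev N (interfaces s) (unlike s i) ≤ L) (h2 : lev N (interfaces s') (unlike s' j) ≤ L) :
    ∀ᶠ γ in nhdsWithin (0 : ℝ) (Set.Ioi 0),
      JoinedIn {x | V N γ x ≤ height N - N / 4 + γ * (L + η)} s s' := by
  filter_upwards [eventually_joinedIn_valley hN hs i hη, eventually_joinedIn_valley hN hs' j hη,
    self_mem_nhdsWithin] with γ e1 e2 hγ
  have hγ : 0 < γ := hγ
  rw [← valley_eq_valley hs hs' hij hi hj hk] at e2
  refine (e1.mono fun x hx => ?_).trans (e2.mono fun x hx => ?_).symm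
  all_goals
    have hx : V N γ x ≤ _ := hx
    refine hx.trans ?_
    have := mul_le_mul_of_nonneg_left h1 hγ.le
    have := mul_le_mul_of_nonneg_left h2 hγ.le
    linarith

/-! ### Barriers -/

/-- A neighbourhood of the configuration `s` whose boundary is high, except near saddles. -/
def basin (s : hyperplane N) : Set (hyperplane N) :=
  {x | (∀ k, -thr N < s.1 k * x.1 k) ∧
    ∀ i j, s.1 i ≠ s.1 j → 0 < s.1 i * x.1 i + s.1 j * x.1 j}

theorem isOpen_basin (s : hyperplane N) : IsOpen (basin s) := by
  have e : basin s = {x | ∀ k, -thr N < s.1 k * x.1 k} ∩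
      {x | ∀ i j, s.1 i ≠ s.1 j → 0 < s.1 i * x.1 i + s.1 j * x.1 j} := rfl
  rw [e]
  refine IsOpen.inter ?_ ?_
  · rw [Set.ofPred_forall]
    exact isOpen_iInter_of_finite fun k => isOpen_lt continuous_const (by fun_prop)
  · simp only [Set.ofPred_forall]
    exact isOpen_iInter_of_finite fun i => isOpen_iInter_of_finite fun j =>
      isOpen_iInter_of_finite fun _ => isOpen_lt continuous_const (by fun_prop)

theorem closure_basin_subset (s : hyperplane N) :
    closure (basin s) ⊆ {x | (∀ k, -thr N ≤ s.1 k * x.1 k) ∧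
      ∀ i j, s.1 i ≠ s.1 j → 0 ≤ s.1 i * x.1 i + s.1 j * x.1 j} := by
  refine closure_minimal (fun x hx => ⟨fun k => (hx.1 k).le, fun i j h => (hx.2 i j h).le⟩) ?_
  have e : {x : hyperplane N | (∀ k, -thr N ≤ s.1 k * x.1 k) ∧
      ∀ i j, s.1 i ≠ s.1 j → 0 ≤ s.1 i * x.1 i + s.1 j * x.1 j}
      = {x | ∀ k, -thr N ≤ s.1 k * x.1 k} ∩
        {x | ∀ i j, s.1 i ≠ s.1 j → 0 ≤ s.1 i * x.1 i + s.1 j * x.1 j} := rfl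
  rw [e]
  refine IsClosed.inter ?_ ?_
  · rw [Set.ofPred_forall]
    exact isClosed_iInter fun k => isClosed_le continuous_const (by fun_prop)
  · simp only [Set.ofPred_forall]
    exact isClosed_iInter fun i => isClosed_iInter fun j =>
      isClosed_iInter fun _ => isClosed_le continuous_const (by fun_prop)

/-- The boundary of the basin consists of points with a coordinate at the central root and points
with two equal coordinates. -/
theorem frontier_basin {s x : hyperplane N} (hx : x ∈ frontier (basin s)) :
    (∀ k, -thr N ≤ s.1 k * x.1 k) ∧
    (∀ i j, s.1 i ≠ s.1 j → 0 ≤ s.1 i * x.1 i + s.1 j * x.1 j) ∧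
    ((∃ i, s.1 i * x.1 i = -thr N) ∨
      ∃ i j, s.1 i ≠ s.1 j ∧ s.1 i * x.1 i + s.1 j * x.1 j = 0) := by
  rw [(isOpen_basin s).frontier_eq] at hx
  obtain ⟨h1, h2⟩ := closure_basin_subset s hx.1
  refine ⟨h1, h2, ?_⟩
  by_contra hcon
  push Not at hcon
  exact hx.2 ⟨fun k => lt_of_le_of_ne (h1 k) (Ne.symm (hcon.1 k)),
    fun i j hij => lt_of_le_of_ne (h2 i j hij) (Ne.symm (hcon.2 i j hij))⟩

/-! ### Lower bounds on the frontier of the basin -/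

theorem tangent_bound {y α μ κ : ℝ} (h : 4 * κ ≤ y ^ 2 + 2 * α * y + 3 * α ^ 2 - 2)
    (hμ : α ^ 3 - α = μ) :
    (α ^ 2 - 1) ^ 2 / 4 + μ * (y - α) + κ * (y - α) ^ 2 ≤ (y ^ 2 - 1) ^ 2 / 4 := by
  have e : (y ^ 2 - 1) ^ 2 / 4 = (α ^ 2 - 1) ^ 2 / 4 + μ * (y - α)
      + (y - α) ^ 2 * (y ^ 2 + 2 * α * y + 3 * α ^ 2 - 2) / 4 := by rw [← hμ]; ring
  rw [e]
  have := mul_le_mul_of_nonneg_left h (sq_nonneg (y - α))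
  linarith

theorem half_ge (hN : 8 ≤ N) : (4 : ℝ) ≤ N / 2 := by
  have : (8 : ℝ) ≤ N := by exact_mod_cast hN
  linarith

/-- The saddle values have a common slope μ, which acts as Lagrange multiplier. On the range of each
coordinate the double well lies above its tangent of slope μ plus a quadratic. The factor y² + 2αy +
3α² − 2 is at least t²(m² − 2m) at sites like i and t²(m² − 4m + 3) at sites unlike i; the latter
equals 3t² at m = 4, whence the constant 3/4. -/
theorem saddle_growth (hN : 8 ≤ N) {s x : hyperplane N} (hs : IsConfig s) {i : ZMod N}
    (h1 : ∀ k, -thr N ≤ s.1 k * x.1 k)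
    (h2 : ∀ i j, s.1 i ≠ s.1 j → 0 ≤ s.1 i * x.1 i + s.1 j * x.1 j)
    (hi : s.1 i * x.1 i = -thr N) :
    height N + 3 / 4 * thr N ^ 2 * ∑ k, (x.1 k - (saddle s hs i).1 k) ^ 2 ≤ excess x := by
  have hm := half_ge hN
  have ht := thr_pos hN
  have hT := thr_sq hN
  unfold invSq at hT
  have hc := saddle_cubic hN
  set μ := (-thr N) ^ 3 - (-thr N) with hμ
  have key : ∀ k, ((saddle s hs i).1 k ^ 2 - 1) ^ 2 / 4
      + μ * s.1 i * (x.1 k - (saddle s hs i).1 k)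
      + 3 / 4 * thr N ^ 2 * (x.1 k - (saddle s hs i).1 k) ^ 2 ≤ (x.1 k ^ 2 - 1) ^ 2 / 4 := by
    intro k
    have hsq := hs.sq i
    obtain ⟨y, hy⟩ : ∃ y, y = s.1 i * x.1 k := ⟨_, rfl⟩
    have hxk : x.1 k = s.1 i * y := by rw [hy]; linear_combination -(x.1 k) * hsq
    obtain ⟨α, hα⟩ : ∃ α, α = (if k = i then -thr N else if s.1 k = s.1 i then
      ((N : ℝ) / 2 - 1) * thr N else -(((N : ℝ) / 2 - 2) * thr N)) := ⟨_, rfl⟩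
    have hz : (saddle s hs i).1 k = s.1 i * α := by rw [hα, saddle, tri_apply]
    have main : (α ^ 2 - 1) ^ 2 / 4 + μ * (y - α) + 3 / 4 * thr N ^ 2 * (y - α) ^ 2
        ≤ (y ^ 2 - 1) ^ 2 / 4 := by
      by_cases hk : k = i
      · have e1 : α = -thr N := by rw [hα, if_pos hk]
        have e2 : y = α := by rw [e1, hy, hk, hi]
        rw [e2]; simp
      · by_cases hki : s.1 k = s.1 i
        · have e1 : α = ((N : ℝ) / 2 - 1) * thr N := by rw [hα, if_neg hk, if_pos hki]
          have hyt : -thr N ≤ y := by rw [hy, ← hki]; exact h1 k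
          refine tangent_bound ?_ (e1 ▸ hc.1)
          rw [e1]
          generalize thr N = t at *
          generalize (N : ℝ) / 2 = m at *
          have e3 : ((m - 2) * t) ^ 2 ≤ (y + (m - 1) * t) ^ 2 :=
            pow_le_pow_left₀ (mul_nonneg (by linarith) ht.le) (by linarith) 2
          nlinarith [mul_nonneg (mul_nonneg (by linarith : 0 ≤ m) (by linarith : 0 ≤ m - 4))
            (sq_nonneg t), mul_nonneg (by linarith : 0 ≤ m - 4) (sq_nonneg t)]
        · have e1 : α = -(((N : ℝ) / 2 - 2) * thr N) := by rw [hα, if_neg hk, if_neg hki]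
          -- Here the pair condition in `basin` is used: with site i at the central root, unlike
          -- sites are forced beyond it.
          have hyt : y ≤ -thr N := by
            have := h2 i k (Ne.symm hki)
            rw [hi, hs.eq_neg (Ne.symm hki)] at this
            rw [hy]; linarith
          refine tangent_bound ?_ (e1 ▸ hc.2)
          rw [e1]
          generalize thr N = t at *
          generalize (N : ℝ) / 2 = m at *
          have e3 : ((m - 1) * t) ^ 2 ≤ (-y + (m - 2) * t) ^ 2 :=
            pow_le_pow_left₀ (mul_nonneg (by linarith) ht.le) (by linarith) 2
          nlinarith [mul_nonneg (mul_nonneg (by linarith : 0 ≤ m) (by linarith : 0 ≤ m - 4))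
            (sq_nonneg t), mul_nonneg (by linarith : 0 ≤ m - 4) (sq_nonneg t)]
    have f1 : (s.1 i * α) ^ 2 = α ^ 2 := by rw [mul_pow, hsq, one_mul]
    have f2 : (s.1 i * y) ^ 2 = y ^ 2 := by rw [mul_pow, hsq, one_mul]
    have f3 : s.1 i * (s.1 i * y - s.1 i * α) = y - α := by linear_combination (y - α) * hsq
    have f4 : (s.1 i * y - s.1 i * α) ^ 2 = (y - α) ^ 2 := by
      rw [← mul_sub, mul_pow, hsq, one_mul]
    rw [hz, hxk, f1, f2, f4, mul_assoc, f3]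
    exact main
  -- The multiplier is the same at all sites, so zero total mass cancels the linear terms.
  have hsum := Finset.sum_le_sum fun k (_ : k ∈ (Finset.univ : Finset (ZMod N))) => key k
  rw [Finset.sum_add_distrib, Finset.sum_add_distrib, ← Finset.mul_sum, ← Finset.mul_sum,
    Finset.sum_sub_distrib, sum_eq_zero, sum_eq_zero] at hsum
  have := excess_saddle hN hs i
  rw [excess] at this ⊢
  linarith

theorem pair_le_excess (x : hyperplane N) {i j : ZMod N} (hij : i ≠ j) :
    (x.1 i ^ 2 - 1) ^ 2 / 4 + (x.1 j ^ 2 - 1) ^ 2 / 4 ≤ excess x := by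
  have := Finset.sum_le_univ_sum_of_nonneg (s := {i, j})
    (f := fun k => (x.1 k ^ 2 - 1) ^ 2 / 4) fun _ => by positivity
  rwa [Finset.sum_pair hij] at this

theorem triple_le_excess (x : hyperplane N) {i j k : ZMod N} (hij : i ≠ j) (hki : k ≠ i)
    (hkj : k ≠ j) :
    (x.1 k ^ 2 - 1) ^ 2 / 4 + ((x.1 i ^ 2 - 1) ^ 2 / 4 + (x.1 j ^ 2 - 1) ^ 2 / 4)
      ≤ excess x := by
  have := Finset.sum_le_univ_sum_of_nonneg (s := {k, i, j})
    (f := fun k => (x.1 k ^ 2 - 1) ^ 2 / 4) fun _ => by positivity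
  rwa [Finset.sum_insert (by simp [hki, hkj]), Finset.sum_pair hij] at this

/-- For N = 8 the equal pair alone costs too little. If another site has s_k x_k < 7/10, it supplies
the missing energy. Otherwise the six other sites must absorb the mass 2c of the pair, at a cost of
at least (18/25)·(2c²/3). -/
theorem excess_eight {s x : hyperplane 8} (hs : IsConfig s)
    (h1 : ∀ k, -thr 8 ≤ s.1 k * x.1 k) {i j : ZMod 8} (hij : s.1 i ≠ s.1 j)
    (hx : x.1 i = x.1 j) : 3 / 7 + 1 / 1000 ≤ excess x := by
  have hij' : i ≠ j := fun h => hij (by rw [h])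
  have ht := thr_sq_le (N := 8) le_rfl
  have ht0 := thr_pos (N := 8) le_rfl
  obtain ⟨c, hc⟩ : ∃ c, c = x.1 i := ⟨_, rfl⟩
  have hcj : x.1 j = c := by rw [hc, hx]
  have hsj := hs.eq_neg hij
  have hc2 : c ^ 2 ≤ 1 / 7 := by
    have a := h1 i
    have b := h1 j
    rw [hcj, hsj] at b
    rw [← hc] at a
    have : (s.1 i * c) ^ 2 ≤ thr 8 ^ 2 := sq_le_sq' a (by linarith)
    rw [mul_pow, hs.sq, one_mul] at this
    exact this.trans ht
  by_contra hcon
  push Not at hcon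
  have hd : ∀ k, k ≠ i → k ≠ j → 7 / 10 ≤ s.1 k * x.1 k := by
    intro k hki hkj
    have h3 := triple_le_excess x hij' hki hkj
    rw [← hc, hcj] at h3
    have h4 : (s.1 k * x.1 k) ^ 2 = x.1 k ^ 2 := by rw [mul_pow, hs.sq, one_mul]
    rw [← h4] at h3
    have h5 := h1 k
    generalize s.1 k * x.1 k = y at *
    by_contra hlt
    push Not at hlt
    have ht1 : thr 8 ≤ 7 / 10 := by nlinarith
    have h6 : y ^ 2 ≤ (7 / 10) ^ 2 := sq_le_sq' (by linarith) hlt.le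
    have h7 : (51 / 100) ^ 2 ≤ (y ^ 2 - 1) ^ 2 := by nlinarith
    have h8 : (6 / 7) ^ 2 ≤ (c ^ 2 - 1) ^ 2 := by nlinarith
    linarith
  -- The deviation x_k − s_k is optimally −c/3 at each of the six sites; its square is bounded below
  -- by the tangent there, which is linear and can be summed.
  have key : ∀ k, (18 / 25) * (-(2 * c / 3) * (x.1 k - s.1 k) - c ^ 2 / 9)
      + (if k = i then (c ^ 2 - 1) ^ 2 / 4
        - (18 / 25) * (-(2 * c / 3) * (c - s.1 i) - c ^ 2 / 9) else 0)
      + (if k = j then (c ^ 2 - 1) ^ 2 / 4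
        - (18 / 25) * (-(2 * c / 3) * (c - s.1 j) - c ^ 2 / 9) else 0)
      ≤ (x.1 k ^ 2 - 1) ^ 2 / 4 := by
    intro k
    by_cases hki : k = i
    · subst hki
      rw [if_pos rfl, if_neg hij', ← hc]
      linarith
    by_cases hkj : k = j
    · subst hkj
      rw [if_neg hki, if_pos rfl, hcj]
      linarith
    rw [if_neg hki, if_neg hkj]
    have h3 := hd k hki hkj
    have e : (x.1 k ^ 2 - 1) ^ 2 = (x.1 k - s.1 k) ^ 2 * (1 + s.1 k * x.1 k) ^ 2 := by
      rcases hs k with h | h <;> rw [h] <;> ring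
    have h4 : (17 / 10) ^ 2 ≤ (1 + s.1 k * x.1 k) ^ 2 :=
      pow_le_pow_left₀ (by norm_num) (by linarith) 2
    have h5 := mul_le_mul_of_nonneg_left h4 (sq_nonneg (x.1 k - s.1 k))
    rw [e]
    nlinarith [sq_nonneg (x.1 k - s.1 k + c / 3), sq_nonneg (x.1 k - s.1 k)]
  have hsum := Finset.sum_le_sum fun k (_ : k ∈ (Finset.univ : Finset (ZMod 8))) => key k
  rw [Finset.sum_add_distrib, Finset.sum_add_distrib, ← Finset.mul_sum, Finset.sum_sub_distrib,
    ← Finset.mul_sum, Finset.sum_sub_distrib, sum_eq_zero, sum_eq_zero, Finset.sum_ite_eq',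
    Finset.sum_ite_eq', if_pos (Finset.mem_univ _), if_pos (Finset.mem_univ _), hsj,
    ← excess] at hsum
  simp only [Finset.sum_const, Finset.card_univ, ZMod.card, nsmul_eq_mul] at hsum
  push_cast at hsum
  have : 0 ≤ (1 / 7 - c ^ 2) * (1 - c ^ 2) :=
    mul_nonneg (by linarith) (by linarith)
  nlinarith

/-- Unlike sites with a common value c have |c| ≤ t, so the pair alone costs at least (1 − t²)²/2.
This exceeds `height N` when m ≥ 5 but not when m = 4. -/
theorem exists_excess_ge_of_eq (hN : 8 ≤ N) (hN2 : Even N) :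
    ∃ ε : ℝ, 0 < ε ∧ ∀ s x : hyperplane N, IsConfig s → (∀ k, -thr N ≤ s.1 k * x.1 k) →
      ∀ i j, s.1 i ≠ s.1 j → x.1 i = x.1 j → height N + ε ≤ excess x := by
  obtain ⟨n, hn⟩ := hN2
  rcases Nat.lt_or_ge N 10 with h | h
  · obtain rfl : N = 8 := by omega
    refine ⟨1 / 1000, by norm_num, fun s x hs h1 i j hij hx => ?_⟩
    have : height 8 = 3 / 7 := by unfold height invSq; norm_num
    rw [this]
    exact excess_eight hs h1 hij hx
  · have hm : (5 : ℝ) ≤ N / 2 := by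
      have : (10 : ℝ) ≤ N := by exact_mod_cast h
      linarith
    have hpos : height N < (thr N ^ 2 - 1) ^ 2 / 2 := by
      rw [height_eq hN]
      have hT := thr_sq hN
      unfold invSq at hT
      have ht := thr_pos hN
      generalize thr N = t at *
      generalize (N : ℝ) / 2 = m at *
      have e1 : t ^ 2 - 1 = -((m - 1) * (m - 2)) * t ^ 2 := by linear_combination hT
      have e2 : t ^ 2 * (m * (m - 1)) / 4
          = t ^ 4 * (m * (m - 1) * (m ^ 2 - 3 * m + 3)) / 4 := by
        linear_combination -(t ^ 2 * (m * (m - 1)) / 4) * hT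
      rw [e1, e2]
      have e3 : (-((m - 1) * (m - 2)) * t ^ 2) ^ 2 / 2
          = t ^ 4 * (2 * ((m - 1) * (m - 2)) ^ 2) / 4 := by ring
      rw [e3]
      refine div_lt_div_of_pos_right (mul_lt_mul_of_pos_left ?_ (by positivity)) (by norm_num)
      obtain ⟨k, rfl⟩ : ∃ k, m = k + 5 := ⟨m - 5, by ring⟩
      have hk : 0 ≤ k := by linarith
      have : 0 < 2 * ((k + 5 - 1) * (k + 5 - 2)) ^ 2
          - (k + 5) * (k + 5 - 1) * ((k + 5) ^ 2 - 3 * (k + 5) + 3) := by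
        ring_nf
        positivity
      linarith
    refine ⟨(thr N ^ 2 - 1) ^ 2 / 2 - height N, by linarith, fun s x hs h1 i j hij hx => ?_⟩
    have h2 := pair_le_excess x (i := i) (j := j) fun h => hij (by rw [h])
    rw [← hx] at h2
    have hc2 : x.1 i ^ 2 ≤ thr N ^ 2 := by
      have a := h1 i
      have b := h1 j
      rw [← hx, hs.eq_neg hij] at b
      have : (s.1 i * x.1 i) ^ 2 ≤ thr N ^ 2 := sq_le_sq' a (by linarith)
      rwa [mul_pow, hs.sq, one_mul] at this
    have h3 := thr_sq_le hN
    have h4 : (1 - thr N ^ 2) ^ 2 ≤ (1 - x.1 i ^ 2) ^ 2 :=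
      pow_le_pow_left₀ (by linarith) (by linarith) 2
    linarith [sub_sq_comm (1 : ℝ) (thr N ^ 2), sub_sq_comm (1 : ℝ) (x.1 i ^ 2)]

/-- The numerator has slope −m(4m − 6) in D. At a fixed number of interfaces, the cheapest exit
flips the site with most unlike neighbours. -/
theorem lev_anti (hN : 8 ≤ N) (I : ℝ) {D D' : ℝ} (h : D ≤ D') : lev N I D' ≤ lev N I D := by
  have h1 := invSq_ge hN
  have hm := half_ge hN
  unfold lev
  refine div_le_div_of_nonneg_right ?_ (by positivity)
  generalize (N : ℝ) / 2 = m at *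
  have : 0 ≤ (D' - D) * (m * (4 * m - 6)) :=
    mul_nonneg (by linarith) (mul_nonneg (by linarith) (by linarith))
  nlinarith

theorem abs_saddle_le (hN : 8 ≤ N) {s : hyperplane N} (hs : IsConfig s) (i k : ZMod N) :
    |(saddle s hs i).1 k| ≤ 2 := by
  have hm := half_ge hN
  have ht := thr_pos hN
  have hT := thr_sq hN
  unfold invSq at hT
  rw [saddle, tri_apply, abs_mul, hs.abs, one_mul]
  generalize thr N = t at *
  generalize (N : ℝ) / 2 = m at *
  have h1 : (m - 1) * t ≤ 2 := by
    rw [← pow_le_pow_iff_left₀ (mul_nonneg (by linarith) ht.le) (by norm_num) two_ne_zero]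
    nlinarith [mul_nonneg (mul_nonneg (by linarith : 0 ≤ m) (by linarith : 0 ≤ m - 4))
            (sq_nonneg t), mul_nonneg (by linarith : 0 ≤ m - 4) (sq_nonneg t), sq_nonneg t]
  have h2 : 0 ≤ (m - 4) * t := mul_nonneg (by linarith) ht.le
  split_ifs
  all_goals
    rw [abs_le]
    constructor <;> linarith

theorem eventually_mul_lt {C ε : ℝ} (hε : 0 < ε) :
    ∀ᶠ γ in nhdsWithin (0 : ℝ) (Set.Ioi 0), γ * C < ε := by
  have : Filter.Tendsto (fun γ : ℝ => γ * C) (nhds 0) (nhds 0) := by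
    have : Continuous fun γ : ℝ => γ * C := by fun_prop
    simpa using this.tendsto 0
  exact (this.eventually (gt_mem_nhds hε)).filter_mono nhdsWithin_le_nhds

/-- At weak coupling, leaving the basin costs the energy of the lowest saddle. -/
theorem eventually_frontier_ge (hN : 8 ≤ N) (hN2 : Even N) {s : hyperplane N} (hs : IsConfig s)
    {D η : ℝ} (hD : ∀ i, unlike s i ≤ D) (hη : 0 < η) :
    ∀ᶠ γ in nhdsWithin (0 : ℝ) (Set.Ioi 0), ∀ x ∈ frontier (basin s),
      height N - N / 4 + γ * (lev N (interfaces s) D - η) ≤ V N γ x := by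
  obtain ⟨ε, hε, H⟩ := exists_excess_ge_of_eq hN hN2
  have ht := thr_pos hN
  have hκ : 0 < 3 / 4 * thr N ^ 2 := by positivity
  filter_upwards [eventually_mul_lt (C := lev N (interfaces s) D - η) hε,
    eventually_mul_lt (C := N * (4 / (3 / 4 * thr N ^ 2))) hη, self_mem_nhdsWithin]
    with γ h1 h2 hγ x hx
  have hγ : 0 < γ := hγ
  obtain ⟨a, b, ⟨i, hi⟩ | ⟨i, j, hij, h0⟩⟩ := frontier_basin hx
  · have h3 := V_ge_of_quadratic_growth hκ hγ.le (abs_saddle_le hN hs i)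
      (saddle_growth hN hs a b hi)
    have h4 := gradSq_saddle hN hs i
    have h5 := mul_le_mul_of_nonneg_left (lev_anti hN (interfaces s) (hD i)) hγ.le
    rw [← h4] at h5
    have h6 : N * (4 * γ ^ 2 / (3 / 4 * thr N ^ 2))
        = γ * (γ * (N * (4 / (3 / 4 * thr N ^ 2)))) := by ring
    have h7 := mul_le_mul_of_nonneg_left h2.le hγ.le
    rw [h6] at h3
    linarith
  · have hxij : x.1 i = x.1 j := by
      rw [hs.eq_neg hij] at h0
      have : s.1 i * (x.1 i - x.1 j) = 0 := by linarith
      rcases mul_eq_zero.1 this with h | h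
      · have := hs.sq i
        rw [h] at this
        norm_num at this
      · linarith
    have h3 := H s x hs a i j hij hxij
    rw [V_eq]
    have := mul_nonneg (div_nonneg hγ.le (by norm_num : (0 : ℝ) ≤ 4)) (gradSq_nonneg x)
    linarith

theorem IsConfig.branch_mem_basin (hN : 8 ≤ N) {s : hyperplane N} (hs : IsConfig s) (γ : ℝ) :
    branch s γ ∈ basin s := by
  have ht := thr_pos hN
  have h := fun i => (hs.mul_mem_box (branch_mem s γ) i).1
  exact ⟨fun k => by linarith [h k], fun i j _ => by linarith [h i, h j]⟩

/-- Where s' differs from s, the coordinate satisfies s_i x_i ≤ −9/10, beyond −t. -/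
theorem IsConfig.branch_notMem_basin (hN : 8 ≤ N) {s s' : hyperplane N} (hs : IsConfig s)
    (hs' : IsConfig s') (hne : s' ≠ s) (γ : ℝ) : branch s' γ ∉ basin s := by
  intro h
  have ht := thr_sq_le hN
  refine hne ?_
  ext i
  by_contra hi
  have h1 := (hs'.mul_mem_box (branch_mem s' γ) i).1
  have h2 := h.1 i
  have h3 : s'.1 i = -s.1 i := by
    rcases hs i with h | h <;> rcases hs' i with h' | h' <;>
      first
      | exact absurd (h'.trans h.symm) hi
      | simp [h, h']
  rw [h3] at h1
  nlinarith

theorem exists_mem_frontier {X : Type*} [TopologicalSpace X] {W : Set X} (hW : IsOpen W) {x y : X}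
    (hx : x ∈ W) (hy : y ∉ W) (p : Path x y) : ∃ t, p t ∈ frontier W := by
  by_contra hcon
  push Not at hcon
  have hr : IsPreconnected (Set.range p) := isPreconnected_range p.continuous
  have := hr.subset_of_closure_inter_subset hW ⟨x, ⟨0, p.source⟩, hx⟩ (by
    rintro z ⟨hz, t, rfl⟩
    by_contra hzW
    exact hcon t (by rw [hW.frontier_eq]; exact ⟨hz, hzW⟩))
  exact hy (this ⟨1, p.target⟩)

/-! ### Combinatorics of configurations -/

/-- A property that passes from each site to the next holds everywhere once it holds somewhere. -/
theorem forall_of_succ {P : ZMod N → Prop} {i : ZMod N} (hi : P i) (h : ∀ k, P k → P (k + 1))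
    (k : ZMod N) : P k := by
  have key : ∀ n : ℕ, P (i + n) := by
    intro n
    induction n with
    | zero => simpa using hi
    | succ n ih => rw [Nat.cast_succ, ← add_assoc]; exact h _ ih
  have := key (k - i).val
  rwa [ZMod.natCast_zmod_val, add_sub_cancel] at this

theorem sum_bonds_update (hN : 2 ≤ N) (f : ZMod N → ℝ) (i : ZMod N) (v : ℝ) :
    ∑ k, Function.update f i v k * Function.update f i v (k + 1)
      = ∑ k, f k * f (k + 1) + (v - f i) * (f (i - 1) + f (i + 1)) := by
  set δ : ZMod N → ℝ := fun k => if k = i then 1 else 0 with hδ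
  have hu : ∀ k, Function.update f i v k = f k + (v - f i) * δ k := by
    intro k
    by_cases hk : k = i
    · subst hk; simp [hδ]
    · simp [hδ, hk]
  have hδδ : ∀ k, δ k * δ (k + 1) = 0 := by
    intro k
    simp only [hδ]
    by_cases hk : k = i
    · subst hk; simp [add_one_ne_self hN]
    · simp [hk]
  have h1 : ∑ k, f k * δ (k + 1) = f (i - 1) := by
    have := sum_shift fun k => f (k - 1) * δ k
    simp only [add_sub_cancel_right] at this
    rw [this]
    simp [hδ]
  have h2 : ∑ k, δ k * f (k + 1) = f (i + 1) := by simp [hδ]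
  have h3 : ∀ k, Function.update f i v k * Function.update f i v (k + 1)
      = f k * f (k + 1) + (v - f i) * (f k * δ (k + 1) + δ k * f (k + 1)) := by
    intro k
    rw [hu, hu]
    linear_combination (v - f i) ^ 2 * hδδ k
  rw [Finset.sum_congr rfl fun k _ => h3 k, Finset.sum_add_distrib, ← Finset.mul_sum,
    Finset.sum_add_distrib, h1, h2]

theorem IsConfig.interfaces_eq_sum_bonds {s : hyperplane N} (hs : IsConfig s) :
    (interfaces s : ℝ) = N / 2 - (∑ k, s.1 k * s.1 (k + 1)) / 2 := by
  rw [hs.interfaces_eq, ← Finset.sum_div, Finset.sum_sub_distrib]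
  simp [ZMod.card]
  ring

theorem IsConfig.exists_exchange {s : hyperplane N} (hs : IsConfig s) {i j : ZMod N}
    (hij : s.1 j = -s.1 i) : ∃ s' : hyperplane N, IsConfig s' ∧ s'.1 i = -s.1 i ∧
      s'.1 j = s.1 i ∧ ∀ k, k ≠ i → k ≠ j → s'.1 k = s.1 k := by
  have hne : j ≠ i := fun h => hs.ne_neg i (h ▸ hij)
  set f : ZMod N → ℝ := Function.update (Function.update (fun k => s.1 k) i (-s.1 i)) j (s.1 i)
    with hf
  have hfk : ∀ k, f k = s.1 k + ((if k = i then -2 * s.1 i else 0)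
      + (if k = j then 2 * s.1 i else 0)) := by
    intro k
    by_cases h1 : k = j
    · subst h1; simp [hf, hne, hij]; ring
    · by_cases h2 : k = i
      · subst h2; simp [hf, h1]; ring
      · simp [hf, h1, h2]
  have hsum : ∑ k, f k = 0 := by
    rw [Finset.sum_congr rfl fun k _ => hfk k, Finset.sum_add_distrib, Finset.sum_add_distrib,
      sum_eq_zero]
    simp
  refine ⟨⟨WithLp.toLp 2 f, hsum⟩, fun k => ?_, ?_, ?_, fun k h1 h2 => ?_⟩
  · change f k = 1 ∨ f k = -1
    by_cases h1 : k = j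
    · subst h1; simpa [hf] using hs i
    · by_cases h2 : k = i
      · subst h2
        have := hs k
        simp only [hf, Function.update_of_ne h1, Function.update_self]
        rcases this with h | h <;> rw [h] <;> norm_num
      · simpa [hf, h1, h2] using hs k
  · change f i = _
    simp [hf, hne.symm]
  · change f j = _
    simp [hf]
  · change f k = _
    simp [hf, h1, h2]

/-- Flipping one site destroys zero mass, so the flipped pattern is only a function on the cycle;
its bond sum corresponds to I + 2 − 2D interfaces. -/
theorem IsConfig.interfaces_flip (hN : 2 ≤ N) {s : hyperplane N} (hs : IsConfig s) (i : ZMod N) :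
    ∑ k, Function.update (fun k => s.1 k) i (-s.1 i) k
      * Function.update (fun k => s.1 k) i (-s.1 i) (k + 1)
      = N - 2 * (interfaces s + 2 - 2 * unlike s i) := by
  rw [sum_bonds_update hN, hs.interfaces_eq_sum_bonds, unlike]
  ring

/-- Flipping i in s and flipping j in s' give the same pattern; its bonds are counted from both
sides. -/
theorem interfaces_exchange (hN : 2 ≤ N) {s s' : hyperplane N} (hs : IsConfig s)
    (hs' : IsConfig s') {i j : ZMod N} (hij : s.1 j = -s.1 i) (hi : s'.1 i = -s.1 i)
    (hj : s'.1 j = s.1 i) (hk : ∀ k, k ≠ i → k ≠ j → s'.1 k = s.1 k) :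
    (interfaces s' : ℝ) = interfaces s - 2 * unlike s i + 2 * unlike s' j := by
  have hne : j ≠ i := fun h => hs.ne_neg i (h ▸ hij)
  have h1 := hs.interfaces_flip hN i
  have h2 := hs'.interfaces_flip hN j
  have h3 : Function.update (fun k => s'.1 k) j (-s'.1 j)
      = Function.update (fun k => s.1 k) i (-s.1 i) := by
    funext k
    by_cases e1 : k = j
    · subst e1; simp [hne, hj, hij]
    · by_cases e2 : k = i
      · subst e2; simp [e1, hi]
      · simp [e1, e2, hk k e2 e1]
  rw [h3, h1] at h2
  linarith

/-- Compares the two saddles on either side of a valley, where I' − 2D' = I − 2D. Unlike in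
`lev_anti`, I varies with D here, and the side with fewer unlike neighbours has the lower saddle. -/
theorem lev_le_lev (hN : 8 ≤ N) {I I' D D' : ℝ} (hD : D' ≤ D)
    (hI : I' ≤ I - 2 * D + 2 * D') : lev N I' D' ≤ lev N I D := by
  have h1 := invSq_ge hN
  have hm := half_ge hN
  unfold lev
  refine div_le_div_of_nonneg_right ?_ (by positivity)
  generalize (N : ℝ) / 2 = m at *
  have e1 := mul_le_mul_of_nonneg_left hI (sq_nonneg (2 * m - 3))
  have e2 : 0 ≤ (D - D') * ((2 * m - 3) * (m - 3)) :=
    mul_nonneg (by linarith) (mul_nonneg (by linarith) (by linarith))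
  nlinarith

variable (N) in
/-- At weak coupling, `s'` can be reached from `s` through saddles of level at most `L`. -/
def Reach (L : ℝ) (s s' : hyperplane N) : Prop :=
  ∀ η > 0, ∀ᶠ γ in nhdsWithin (0 : ℝ) (Set.Ioi 0),
    JoinedIn {x | V N γ x ≤ height N - N / 4 + γ * (L + η)} s s'

theorem Reach.mono {L L' : ℝ} (h : L ≤ L') {s s' : hyperplane N} (hr : Reach N L s s') :
    Reach N L' s s' := by
  intro η hη
  filter_upwards [hr η hη, self_mem_nhdsWithin] with γ h1 hγ
  have hγ : 0 < γ := hγ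
  refine h1.mono fun x hx => ?_
  have hx : V N γ x ≤ _ := hx
  refine hx.trans ?_
  have := mul_le_mul_of_nonneg_left h hγ.le
  linarith

theorem Reach.trans {L : ℝ} {s s' s'' : hyperplane N} (h : Reach N L s s')
    (h' : Reach N L s' s'') : Reach N L s s'' := by
  intro η hη
  filter_upwards [h η hη, h' η hη] with γ h1 h2
  exact h1.trans h2

/-- The site j is chosen next to a site j + 1 of its new sign. After the exchange j has at most one
unlike neighbour, so the far saddle is no higher than the near one. -/
theorem IsConfig.exists_move (hN : 8 ≤ N) {s : hyperplane N} (hs : IsConfig s) {i j : ZMod N}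
    (hij : s.1 j = -s.1 i) (hj : s.1 (j + 1) = s.1 i) (hji : j + 1 ≠ i) (hD : 1 ≤ unlike s i) :
    ∃ s' : hyperplane N, IsConfig s' ∧ s'.1 i = -s.1 i ∧ s'.1 j = s.1 i ∧
      (∀ k, k ≠ i → k ≠ j → s'.1 k = s.1 k) ∧
      ((interfaces s' : ℝ) = interfaces s - 2 * unlike s i + 2 ∨
        (interfaces s' : ℝ) = interfaces s - 2 * unlike s i) ∧
      Reach N (lev N (interfaces s) (unlike s i)) s s' := by
  obtain ⟨s', hs', h1, h2, h3⟩ := hs.exists_exchange hij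
  have hI := interfaces_exchange (by omega) hs hs' hij h1 h2 h3
  have h4 : s'.1 (j + 1) = s.1 i := by
    rw [h3 _ hji (add_one_ne_self (by omega) j), hj]
  have hD' : unlike s' j = 1 ∨ unlike s' j = 0 := by
    rw [unlike, h4, h2]
    rcases hs i with a | a <;> rcases hs' (j - 1) with b | b <;> rw [a, b] <;> norm_num
  refine ⟨s', hs', h1, h2, h3, ?_, fun η hη => ?_⟩
  · rcases hD' with h | h <;> rw [h] at hI
    · left; linarith
    · right; linarith
  · refine eventually_joinedIn_exchange hN hs hs' hij h1 h2 h3 hη le_rfl ?_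
    refine lev_le_lev hN ?_ hI.le
    rcases hD' with h | h <;> rw [h] <;> linarith

theorem IsConfig.unlike_eq_two_iff {s : hyperplane N} (hs : IsConfig s) (i : ZMod N) :
    unlike s i = 2 ↔ IsIsolated s i := by
  unfold unlike IsIsolated
  rcases hs i with a | a <;> rcases hs (i - 1) with b | b <;> rcases hs (i + 1) with c | c <;>
    rw [a, b, c] <;> norm_num

theorem IsConfig.unlike_le_one {s : hyperplane N} (hs : IsConfig s) {i : ZMod N}
    (h : ¬ IsIsolated s i) : unlike s i ≤ 1 := by
  rw [← hs.unlike_eq_two_iff] at h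
  unfold unlike at h ⊢
  rcases hs i with a | a <;> rcases hs (i - 1) with b | b <;> rcases hs (i + 1) with c | c <;>
    rw [a, b, c] at h ⊢ <;>
    first
    | (clear h; norm_num; done)
    | (exfalso; revert h; norm_num; done)

theorem IsConfig.exists_descent_of_isolated (hN : 8 ≤ N) {s : hyperplane N} (hs : IsConfig s)
    {i : ZMod N} (hi : IsIsolated s i) : ∃ s' : hyperplane N, IsConfig s' ∧
      interfaces s' < interfaces s ∧ Reach N (lev N (interfaces s) 2) s s' := by
  have hD := (hs.unlike_eq_two_iff i).2 hi
  obtain ⟨j, hj0, hj1, hji⟩ : ∃ j, s.1 j = -s.1 i ∧ s.1 (j + 1) = s.1 i ∧ j + 1 ≠ i := by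
    by_contra hcon
    push Not at hcon
    -- Without such a j, the sign −s_i propagates around the whole cycle, leaving i alone with its
    -- sign; this contradicts zero mass.
    have hall : ∀ k, k = i ∨ s.1 k = -s.1 i := by
      refine forall_of_succ (i := i) (Or.inl rfl) fun k hk => ?_
      by_cases h1 : k + 1 = i
      · exact Or.inl h1
      · right
        rcases hk with rfl | hk
        · exact hs.eq_neg hi.2
        · by_contra h2
          refine h1 (hcon k hk ?_)
          by_contra h3
          exact h2 (hs.eq_neg (Ne.symm h3))
    have hsum : ∑ k, s.1 k = ∑ k, (-s.1 i + if k = i then 2 * s.1 i else 0) := by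
      refine Finset.sum_congr rfl fun k _ => ?_
      by_cases hk : k = i
      · subst hk; simp; ring
      · rw [(hall k).resolve_left hk]; simp [hk]
    rw [sum_eq_zero, Finset.sum_add_distrib] at hsum
    simp [ZMod.card] at hsum
    have h8 : (8 : ℝ) ≤ N := by exact_mod_cast hN
    rcases hs i with h | h <;> rw [h] at hsum <;> linarith
  obtain ⟨s', hs', -, -, -, hI, hr⟩ := hs.exists_move hN hj0 hj1 hji (by rw [hD]; norm_num)
  rw [hD] at hI hr
  refine ⟨s', hs', ?_, hr⟩
  have : (interfaces s' : ℝ) < interfaces s := by rcases hI with h | h <;> linarith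
  exact_mod_cast this

/-- The signed increments of s sum to zero around the cycle. If l − 1 were the only change towards
the sign of s_l, this would bound `gradSq` by 8, that is, allow only two interfaces. -/
theorem IsConfig.exists_second_upcrossing {s : hyperplane N} (hs : IsConfig s)
    (hI : 4 ≤ interfaces s) {l : ZMod N} (hl : s.1 (l - 1) ≠ s.1 l) :
    ∃ j, j ≠ l - 1 ∧ s.1 j = -s.1 l ∧ s.1 (j + 1) = s.1 l := by
  by_contra hcon
  push Not at hcon
  have hneg := hs.eq_neg hl.symm
  have key : ∀ k, (s.1 (k + 1) - s.1 k) ^ 2 ≤ -2 * s.1 l * (s.1 (k + 1) - s.1 k)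
      + if k = l - 1 then 8 else 0 := by
    intro k
    by_cases hk : k = l - 1
    · subst hk
      rw [if_pos rfl, sub_add_cancel, hneg]
      nlinarith [hs.sq l]
    · rw [if_neg hk]
      have := hcon k hk
      rcases hs l with a | a <;> rcases hs k with b | b <;> rcases hs (k + 1) with c | c <;>
        rw [a, b, c] at this ⊢ <;>
        first
        | (clear this; norm_num; done)
        | (exfalso; revert this; norm_num; done)
  have hsum := Finset.sum_le_sum fun k (_ : k ∈ (Finset.univ : Finset (ZMod N))) => key k
  rw [← gradSq, hs.gradSq_eq, Finset.sum_add_distrib, ← Finset.mul_sum, Finset.sum_sub_distrib,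
    sum_shift fun k => s.1 k, sub_self, mul_zero, zero_add, Finset.sum_ite_eq',
    if_pos (Finset.mem_univ _)] at hsum
  have : (4 : ℝ) ≤ interfaces s := by exact_mod_cast hI
  linarith

/-- Shrinking an interval of length `n` until it is an isolated site. -/
theorem exists_descent_of_run (hN : 8 ≤ N) (n : ℕ) : ∀ {s : hyperplane N}, IsConfig s →
    4 ≤ interfaces s → ∀ l : ZMod N, s.1 (l - 1) ≠ s.1 l → (∀ k < n, s.1 (l + k) = s.1 l) →
    s.1 (l + n) ≠ s.1 l → ∃ s' : hyperplane N, IsConfig s' ∧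
      interfaces s' < interfaces s ∧ Reach N (lev N (interfaces s) 1) s s' := by
  induction n with
  | zero => intro s hs _ l _ _ h; simp at h
  | succ n ih =>
    intro s hs hI l hl hrun hend
    rcases Nat.eq_zero_or_pos n with rfl | hn
    · have hiso : IsIsolated s l := ⟨hl, by simpa using hend.symm⟩
      obtain ⟨s', hs', h1, h2⟩ := hs.exists_descent_of_isolated hN hiso
      exact ⟨s', hs', h1, h2.mono (lev_anti hN _ (by norm_num))⟩
    -- The right end of the run is flipped and the lost site is attached to the left of another run
    -- of the same sign. Requiring j ≠ l − 1 prevents the run from being merely translated.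
    · obtain ⟨j, hjl, hj0, hj1⟩ := hs.exists_second_upcrossing hI hl
      set i : ZMod N := l + n with hi
      have hsi : s.1 i = s.1 l := hrun n (by omega)
      have hi1 : s.1 (i + 1) = -s.1 l := by
        have : i + 1 = l + ((n + 1 : ℕ) : ZMod N) := by rw [hi]; push_cast; ring
        rw [this]
        exact hs.eq_neg hend.symm
      have hi0 : s.1 (i - 1) = s.1 l := by
        have : i - 1 = l + ((n - 1 : ℕ) : ZMod N) := by
          rw [hi, Nat.cast_sub hn]; push_cast; ring
        rw [this]
        exact hrun _ (by omega)
      have hD : unlike s i = 1 := by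
        rw [unlike, hi1, hi0]; ring
      have hne := hs.ne_neg l
      have hji : j + 1 ≠ i := by
        intro h
        rw [← h, add_sub_cancel_right, hj0] at hi0
        exact hne hi0.symm
      obtain ⟨s', hs', a1, a2, a3, a4, a5⟩ := hs.exists_move hN (i := i) (j := j)
        (by rw [hj0, hsi]) (by rw [hj1, hsi]) hji hD.ge
      rw [hD] at a4 a5
      rcases a4 with a4 | a4
      -- With the number of interfaces unchanged, the run starting at l is one site shorter and the
      -- level is the same, so the induction hypothesis applies.
      · have hII : interfaces s' = interfaces s := by
          have : (interfaces s' : ℝ) = interfaces s := by linarith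
          exact_mod_cast this
        have hl1 : s.1 (l - 1) = -s.1 l := hs.eq_neg hl.symm
        have hlj : l ≠ j := by
          intro h; rw [← h] at hj0; exact hne hj0
        have hli : l ≠ i := by
          intro h
          rw [← h, hl1] at hi0
          exact hne hi0.symm
        have hl1i : l - 1 ≠ i := by
          intro h; rw [h, hsi] at hl1; exact hne hl1
        have b1 : s'.1 l = s.1 l := a3 l hli hlj
        have b2 : s'.1 (l - 1) = -s.1 l := by rw [a3 _ hl1i hjl.symm, hl1]
        obtain ⟨s'', c1, c2, c3⟩ := ih hs' (by omega) l (by rw [b1, b2]; exact hne.symm)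
          (fun k hk => by
            rw [b1]
            have e1 : l + (k : ZMod N) ≠ i := by
              intro h
              have e2 := hrun (k + 1) (by omega)
              have : l + ((k + 1 : ℕ) : ZMod N) = i + 1 := by rw [← h]; push_cast; ring
              rw [this, hi1] at e2
              exact hne e2.symm
            have e3 : l + (k : ZMod N) ≠ j := by
              intro h
              have e2 := hrun k (by omega)
              rw [h, hj0] at e2
              exact hne e2.symm
            rw [a3 _ e1 e3, hrun k (by omega)])
          (by rw [b1, a1, hsi]; exact hne.symm)
        rw [hII] at c2 c3
        exact ⟨s'', c1, c2, a5.trans c3⟩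
      · refine ⟨s', hs', ?_, a5⟩
        have : (interfaces s' : ℝ) < interfaces s := by linarith
        exact_mod_cast this

open Classical in
/-- The largest possible number of unlike neighbours of a site. -/
def maxUnlike (s : hyperplane N) : ℝ := if ∃ i, IsIsolated s i then 2 else 1

theorem IsConfig.unlike_le {s : hyperplane N} (hs : IsConfig s) (i : ZMod N) :
    unlike s i ≤ maxUnlike s := by
  unfold maxUnlike
  split_ifs with h
  · by_cases hi : IsIsolated s i
    · exact ((hs.unlike_eq_two_iff i).2 hi).le
    · exact (hs.unlike_le_one hi).trans (by norm_num)
  · exact hs.unlike_le_one fun hi => h ⟨i, hi⟩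

theorem maxUnlike_le (s : hyperplane N) : maxUnlike s ≤ 2 := by
  unfold maxUnlike; split_ifs <;> norm_num

theorem one_le_maxUnlike (s : hyperplane N) : 1 ≤ maxUnlike s := by
  unfold maxUnlike; split_ifs <;> norm_num

theorem IsConfig.exists_interface {s : hyperplane N} (hs : IsConfig s) :
    ∃ l, s.1 (l - 1) ≠ s.1 l := by
  have h := hs.interfaces_ne_zero
  obtain ⟨k, hk⟩ := Finset.card_ne_zero.1 h
  exact ⟨k + 1, by simpa using (Finset.mem_filter.1 hk).2⟩

theorem IsConfig.exists_descent (hN : 8 ≤ N) {s : hyperplane N} (hs : IsConfig s)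
    (hI : 4 ≤ interfaces s) : ∃ s' : hyperplane N, IsConfig s' ∧
      interfaces s' < interfaces s ∧ Reach N (lev N (interfaces s) (maxUnlike s)) s s' := by
  unfold maxUnlike
  split_ifs with h
  · obtain ⟨i, hi⟩ := h
    exact hs.exists_descent_of_isolated hN hi
  · obtain ⟨l, hl⟩ := hs.exists_interface
    have hex : ∃ n : ℕ, s.1 (l + n) ≠ s.1 l := by
      refine ⟨(-1 : ZMod N).val, ?_⟩
      rw [ZMod.natCast_zmod_val, ← sub_eq_add_neg]
      exact hl
    classical
    refine exists_descent_of_run hN (Nat.find hex) hs hI l hl (fun k hk => ?_)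
      (Nat.find_spec hex)
    by_contra hne
    exact Nat.find_min hex hk hne

/-- Descending to the configurations with two interfaces. -/
theorem exists_reach_two (hN : 8 ≤ N) (n : ℕ) : ∀ {s : hyperplane N}, IsConfig s →
    interfaces s = n → 4 ≤ n → ∃ s' : hyperplane N, IsConfig s' ∧
      interfaces s' = 2 ∧ Reach N (lev N (interfaces s) (maxUnlike s)) s s' := by
  induction n using Nat.strong_induction_on with
  | _ n ih =>
    intro s hs hn h4
    obtain ⟨s', hs', h1, h2⟩ := hs.exists_descent hN (by omega)
    obtain ⟨a, ha⟩ := hs.even_interfaces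
    obtain ⟨b, hb⟩ := hs'.even_interfaces
    have h3 := hs'.two_le_interfaces
    rcases Nat.eq_or_lt_of_le h3 with h5 | h5
    · exact ⟨s', hs', h5.symm, h2⟩
    · obtain ⟨s'', c1, c2, c3⟩ := ih (interfaces s') (by omega) hs' rfl (by omega)
      refine ⟨s'', c1, c2, h2.trans (c3.mono ?_)⟩
      -- Since I' ≤ I − 2, even `lev N I' 1` is at most `lev N I 2`, so later stages never exceed
      -- the first level, isolated sites or not.
      refine (lev_anti hN _ (one_le_maxUnlike s')).trans (le_trans ?_
        (lev_anti hN _ (maxUnlike_le s)))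
      refine lev_le_lev hN (by norm_num) ?_
      have : ((interfaces s' + 2 : ℕ) : ℝ) ≤ interfaces s := by exact_mod_cast (by omega)
      push_cast at this
      linarith

/-- Without isolated sites no two consecutive bonds are interfaces, so the set of interfaces is
disjoint from its translate by one. -/
theorem two_mul_interfaces_le {s : hyperplane N}
    (h : ∀ i, ¬ IsIsolated s i) : 2 * interfaces s ≤ N := by
  set E := Finset.univ.filter fun i : ZMod N => s.1 i ≠ s.1 (i + 1) with hE
  have hdisj : Disjoint E (E.map (Equiv.addRight (1 : ZMod N)).toEmbedding) := by
    rw [Finset.disjoint_left]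
    intro k hk hk'
    obtain ⟨j, hj, rfl⟩ := Finset.mem_map.1 hk'
    rw [hE, Finset.mem_filter] at hk hj
    refine h (j + 1) ⟨?_, by simpa using hk.2⟩
    rw [add_sub_cancel_right]
    exact hj.2
  have := Finset.card_le_univ (E ∪ E.map (Equiv.addRight (1 : ZMod N)).toEmbedding)
  rw [Finset.card_union_of_disjoint hdisj, Finset.card_map, ZMod.card] at this
  have hcard : E.card = interfaces s := rfl
  omega

theorem IsConfig.not_isolated_of_two (hN : 8 ≤ N) {s : hyperplane N} (hs : IsConfig s)
    (h : interfaces s = 2) (i : ZMod N) : ¬ IsIsolated s i := by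
  intro hi
  obtain ⟨s', hs', h1, -⟩ := hs.exists_descent_of_isolated hN hi
  have := hs'.two_le_interfaces
  omega

/-- The first-order cost of leaving the basin of `s`. -/
def cost (s : hyperplane N) : ℝ := lev N (interfaces s) (maxUnlike s) - interfaces s

theorem lev_sub (hN : 8 ≤ N) (I D : ℝ) : lev N I D - I
    = (2 * ((N : ℝ) / 2) ^ 2 - 3 * I - D * (4 * ((N : ℝ) / 2) ^ 2 - 6 * (N / 2)))
      / (4 * invSq N) := by
  have h1 := invSq_ge hN
  unfold lev
  rw [eq_div_iff (by positivity), sub_mul, div_mul_cancel₀ _ (by positivity)]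
  unfold invSq
  ring

theorem cost_lt_of_maxUnlike_eq (hN : 8 ≤ N) {s s' : hyperplane N}
    (h : maxUnlike s = maxUnlike s') (hI : interfaces s < interfaces s') : cost s' < cost s := by
  have h1 := invSq_ge hN
  rw [cost, cost, lev_sub hN, lev_sub hN, h]
  refine div_lt_div_of_pos_right ?_ (by positivity)
  have : (interfaces s : ℝ) < interfaces s' := by exact_mod_cast hI
  linarith

/-- Passing from D = 1 to D = 2 lowers the numerator in `lev_sub` by 4m² − 6m, while interfaces
account for at most 3N = 6m, which is smaller since m > 3. -/
theorem cost_lt_of_isolated (hN : 8 ≤ N) {s s' : hyperplane N}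
    (h : maxUnlike s = 1) (h' : maxUnlike s' = 2) : cost s' < cost s := by
  have h1 := invSq_ge hN
  have hm := half_ge hN
  rw [cost, cost, lev_sub hN, lev_sub hN, h, h']
  refine div_lt_div_of_pos_right ?_ (by positivity)
  have h2 : (interfaces s : ℝ) ≤ N := by exact_mod_cast interfaces_le s
  have h3 : (0 : ℝ) ≤ interfaces s' := by positivity
  nlinarith

theorem IsConfig.exists_reach_lower (hN : 8 ≤ N) {s : hyperplane N} (hs : IsConfig s)
    (hI : 4 ≤ interfaces s) : ∃ s' : hyperplane N, IsConfig s' ∧ cost s < cost s' ∧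
      Reach N (lev N (interfaces s) (maxUnlike s)) s s' := by
  obtain ⟨s', h1, h2, h3⟩ := exists_reach_two hN _ hs rfl hI
  refine ⟨s', h1, ?_, h3⟩
  have h4 : maxUnlike s' = 1 := by
    unfold maxUnlike
    rw [if_neg]
    rintro ⟨i, hi⟩
    exact h1.not_isolated_of_two hN h2 i hi
  by_cases h : ∃ i, IsIsolated s i
  · exact cost_lt_of_isolated hN h4 (by unfold maxUnlike; rw [if_pos h])
  · exact cost_lt_of_maxUnlike_eq hN (by rw [h4]; unfold maxUnlike; rw [if_neg h]) (by omega)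

/-! ### Existence of configurations in each family -/

theorem sum_zmod_eq_sum_range (F : ZMod N → ℝ) :
    ∑ k, F k = ∑ n ∈ Finset.range N, F (n : ZMod N) := by
  refine Finset.sum_nbij' (fun k => k.val) (fun n => (n : ZMod N)) ?_ ?_ ?_ ?_ ?_
  · intro k _; exact Finset.mem_range.2 (ZMod.val_lt k)
  · intro n _; exact Finset.mem_univ _
  · intro k _; exact ZMod.natCast_zmod_val k
  · intro n hn; exact ZMod.val_natCast_of_lt (Finset.mem_range.1 hn)
  · intro k _; rw [ZMod.natCast_zmod_val]

/-- The periodic configuration with a prescribed sequence of signs. -/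
theorem exists_config_of_seq {n : ℕ} (hn : N = n + 1) {g : ℕ → ℝ} (hg : ∀ k, g k = 1 ∨ g k = -1)
    (hsum : ∑ k ∈ Finset.range (n + 1), g k = 0) :
    ∃ s : hyperplane N, IsConfig s ∧ (∀ k < N, s.1 (k : ZMod N) = g k) ∧
      (interfaces s : ℝ) =
        N / 2 - (∑ k ∈ Finset.range n, g k * g (k + 1) + g n * g 0) / 2 := by
  have hval : ∀ k < N, g ((k : ZMod N).val) = g k := fun k hk => by
    rw [ZMod.val_natCast_of_lt hk]
  have h0 : ∑ k : ZMod N, g k.val = 0 := by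
    rw [sum_zmod_eq_sum_range, ← hsum, hn.symm]
    exact Finset.sum_congr rfl fun k hk => hval k (Finset.mem_range.1 hk)
  refine ⟨⟨WithLp.toLp 2 fun k => g k.val, h0⟩, fun k => hg _, hval, ?_⟩
  rw [IsConfig.interfaces_eq_sum_bonds fun k => hg _]
  congr 2
  change ∑ k : ZMod N, g k.val * g (k + 1).val = _
  refine (sum_zmod_eq_sum_range fun k : ZMod N => g k.val * g (k + 1).val).trans ?_
  have hr : Finset.range N = Finset.range (n + 1) := by rw [hn]
  rw [hr, Finset.sum_range_succ]
  congr 1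
  · refine Finset.sum_congr rfl fun k hk => ?_
    have hk := Finset.mem_range.1 hk
    have h1 := hval (k + 1) (by omega)
    push_cast at h1
    rw [hval k (by omega), h1]
  · have h1 : (n : ZMod N) + 1 = 0 := by
      rw [← Nat.cast_succ, Nat.succ_eq_add_one, ← hn]; simp
    rw [hval n (by omega), h1, ZMod.val_zero]

theorem blockSeq_spec {L n : ℕ} (hn : n + 1 = 2 * L) (g : ℕ → ℝ)
    (hg : ∀ k, g k = if k < L then 1 else -1) :
    ∑ k ∈ Finset.range (n + 1), g k = 0 ∧
    ∑ k ∈ Finset.range n, g k * g (k + 1) = n - 2 := by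
  constructor
  · rw [hn, two_mul, Finset.sum_range_add]
    have e1 : ∑ k ∈ Finset.range L, g k = ∑ _k ∈ Finset.range L, (1 : ℝ) :=
      Finset.sum_congr rfl fun k hk => by rw [hg, if_pos (Finset.mem_range.1 hk)]
    have e2 : ∑ k ∈ Finset.range L, g (L + k) = ∑ _k ∈ Finset.range L, (-1 : ℝ) :=
      Finset.sum_congr rfl fun k _ => by rw [hg, if_neg (by omega)]
    rw [e1, e2]
    simp
  · have : ∀ k ∈ Finset.range n, g k * g (k + 1) = 1 + if k = L - 1 then -2 else 0 := by
      intro k hk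
      rw [hg, hg]
      by_cases h : k = L - 1
      · rw [if_pos (by omega), if_neg (by omega), if_pos h]; norm_num
      · by_cases h2 : k < L
        · rw [if_pos h2, if_pos (by omega), if_neg h]; norm_num
        · rw [if_neg h2, if_neg (by omega), if_neg h]; norm_num
    rw [Finset.sum_congr rfl this, Finset.sum_add_distrib, Finset.sum_ite_eq',
      if_pos (Finset.mem_range.2 (by omega))]
    simp
    ring

/-- `r` isolated particle-hole pairs, followed by two blocks of length `L`. -/
theorem exists_isolated_seq {L : ℕ} (hL : 1 ≤ L) (r : ℕ) : ∀ n : ℕ, n + 1 = 2 * r + 2 * L →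
    ∃ g : ℕ → ℝ, (∀ k, g k = 1 ∨ g k = -1) ∧ ∑ k ∈ Finset.range (n + 1), g k = 0 ∧
      ∑ k ∈ Finset.range n, g k * g (k + 1) = n - 2 * (2 * r + 1) ∧ g 0 = 1 ∧ g n = -1 ∧
      (1 ≤ r → g 1 = -1 ∧ g 2 = 1) := by
  induction r with
  | zero =>
    intro n hn
    obtain ⟨h1, h2⟩ := blockSeq_spec (L := L) (n := n) (by omega)
      (fun k => if k < L then 1 else -1) fun _ => rfl
    refine ⟨fun k => if k < L then 1 else -1, fun k => ?_, h1, by rw [h2]; norm_num,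
      if_pos (by omega), if_neg (by omega), by omega⟩
    dsimp only
    split_ifs <;> simp
  | succ r ih =>
    intro n hn
    obtain ⟨n, rfl⟩ : ∃ n', n = n' + 2 := ⟨n - 2, by omega⟩
    obtain ⟨g, h1, h2, h3, h4, h5, -⟩ := ih n (by omega)
    let g' : ℕ → ℝ := fun k => match k with
      | 0 => 1
      | 1 => -1
      | k + 2 => g k
    have e : ∀ k, g' (k + 2) = g k := fun _ => rfl
    have e0 : g' 0 = 1 := rfl
    have e1 : g' 1 = -1 := rfl
    refine ⟨g', fun k => ?_, ?_, ?_, rfl, h5, fun _ => ⟨rfl, h4⟩⟩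
    · match k with
      | 0 => exact Or.inl rfl
      | 1 => exact Or.inr rfl
      | k + 2 => exact h1 k
    · rw [Finset.sum_range_succ', Finset.sum_range_succ']
      simp only [zero_add, add_assoc, Nat.reduceAdd, e, e0, e1, h2]
      norm_num
    · rw [Finset.sum_range_succ', Finset.sum_range_succ']
      have e3 : ∀ k, g' (k + 1 + 1 + 1) = g (k + 1) := fun _ => rfl
      have e4 : g' (0 + 1 + 1) = g 0 := rfl
      have e5 : ∀ k, g' (k + 1 + 1) = g k := fun _ => rfl
      simp only [e3, e4, e5, zero_add, e0, e1, h3, h4]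
      push_cast
      ring

/-- `r` pairs of blocks of length two, followed by two blocks of length `L`. -/
theorem exists_nonisolated_seq {L : ℕ} (hL : 2 ≤ L) (r : ℕ) : ∀ n : ℕ, n + 1 = 4 * r + 2 * L →
    ∃ g : ℕ → ℝ, (∀ k, g k = 1 ∨ g k = -1) ∧ ∑ k ∈ Finset.range (n + 1), g k = 0 ∧
      ∑ k ∈ Finset.range n, g k * g (k + 1) = n - 2 * (2 * r + 1) ∧ g 0 = 1 ∧ g n = -1 ∧
      g 1 = 1 ∧ (∀ k, k + 1 = n → g k = -1) ∧
      (∀ k, k + 2 ≤ n → g k ≠ g (k + 1) → g (k + 1) = g (k + 2)) := by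
  induction r with
  | zero =>
    intro n hn
    obtain ⟨h1, h2⟩ := blockSeq_spec (L := L) (n := n) (by omega)
      (fun k => if k < L then 1 else -1) fun _ => rfl
    refine ⟨fun k => if k < L then 1 else -1, fun k => ?_, h1, by rw [h2]; norm_num,
      if_pos (by omega), if_neg (by omega), if_pos (by omega), fun k hk => if_neg (by omega),
      fun k hk hne => ?_⟩
    · dsimp only
      split_ifs <;> simp
    · dsimp only at hne ⊢
      by_cases h : k + 1 < L
      · exact absurd (by rw [if_pos h, if_pos (by omega)]) hne
      · rw [if_neg h, if_neg (by omega)]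
  | succ r ih =>
    intro n hn
    obtain ⟨n, rfl⟩ : ∃ n', n = n' + 4 := ⟨n - 4, by omega⟩
    obtain ⟨g, h1, h2, h3, h4, h5, h6, h7, h8⟩ := ih n (by omega)
    let g' : ℕ → ℝ := fun k => match k with
      | 0 => 1
      | 1 => 1
      | 2 => -1
      | 3 => -1
      | k + 4 => g k
    have e0 : g' 0 = 1 := rfl
    have e1 : g' 1 = 1 := rfl
    have e2 : g' 2 = -1 := rfl
    have e3 : g' 3 = -1 := rfl
    have e : ∀ k, g' (k + 4) = g k := fun _ => rfl
    refine ⟨g', fun k => ?_, ?_, ?_, rfl, h5, rfl, fun k hk => ?_, fun k hk hne => ?_⟩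
    · match k with
      | 0 => exact Or.inl rfl
      | 1 => exact Or.inl rfl
      | 2 => exact Or.inr rfl
      | 3 => exact Or.inr rfl
      | k + 4 => exact h1 k
    · rw [Finset.sum_range_succ', Finset.sum_range_succ', Finset.sum_range_succ',
        Finset.sum_range_succ']
      simp only [zero_add, add_assoc, Nat.reduceAdd, e, e0, e1, e2, e3, h2]
      norm_num
    · rw [Finset.sum_range_succ', Finset.sum_range_succ', Finset.sum_range_succ',
        Finset.sum_range_succ']
      have f1 : ∀ k, g' (k + 1 + 1 + 1 + 1 + 1) = g (k + 1) := fun _ => rfl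
      have f2 : ∀ k, g' (k + 1 + 1 + 1 + 1) = g k := fun _ => rfl
      have f4 : g' (0 + 1 + 1 + 1) = -1 := rfl
      have f5 : g' (0 + 1 + 1) = -1 := rfl
      simp only [f1, f2, f4, f5, zero_add, e0, e1, h3, h4]
      push_cast
      ring
    · obtain ⟨k, rfl⟩ : ∃ k', k = k' + 4 := ⟨k - 4, by omega⟩
      exact h7 k (by omega)
    · match k, hk, hne with
      | 0, _, hne => exact absurd rfl hne
      | 1, _, _ => rfl
      | 2, _, hne => exact absurd rfl hne
      | 3, _, _ => exact h4.trans h6.symm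
      | k + 4, hk, hne => exact h8 k (by omega) hne

/-- The sequence has 2r + 1 sign changes, and the bond closing the cycle is one more. If r ≥ 1, site
1 is isolated. -/
theorem exists_config_isolated (hN2 : Even N) (r : ℕ) (hr : 2 * (r + 1) ≤ N) :
    ∃ s : hyperplane N, IsConfig s ∧ interfaces s = 2 * r + 2 ∧
      (1 ≤ r → ∃ i, IsIsolated s i) := by
  obtain ⟨M, hM⟩ := hN2
  obtain ⟨n, hn⟩ : ∃ n, N = n + 1 := ⟨N - 1, by omega⟩
  obtain ⟨g, h1, h2, h3, h4, h5, h6⟩ := exists_isolated_seq (L := M - r) (by omega) r n (by omega)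
  obtain ⟨s, hs, hk, hI⟩ := exists_config_of_seq hn h1 h2
  refine ⟨s, hs, ?_, fun hr1 => ⟨1, ?_⟩⟩
  · have hNn : (N : ℝ) = n + 1 := by exact_mod_cast hn
    rw [h3, h4, h5] at hI
    have : (interfaces s : ℝ) = (2 * r + 2 : ℕ) := by rw [hI, hNn]; push_cast; ring
    exact_mod_cast this
  · obtain ⟨a, b⟩ := h6 hr1
    have k0 := hk 0 (by omega)
    have k1 := hk 1 (by omega)
    have k2 := hk 2 (by omega)
    push_cast at k0 k1 k2
    rw [IsIsolated, sub_self, one_add_one_eq_two, k0, k1, k2, h4, a, b]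
    norm_num

/-- Besides blocks of length at least two inside, the sequence begins with two equal values and ends
with two equal values, so nothing is isolated at the seam of the cycle. -/
theorem exists_config_nonisolated (hN2 : Even N) (r : ℕ) (hr : 4 * (r + 1) ≤ N) :
    ∃ s : hyperplane N, IsConfig s ∧ interfaces s = 2 * r + 2 ∧ ∀ i, ¬ IsIsolated s i := by
  obtain ⟨M, hM⟩ := hN2
  obtain ⟨n, hn⟩ : ∃ n, N = n + 1 := ⟨N - 1, by omega⟩
  obtain ⟨g, h1, h2, h3, h4, h5, h6, h7, h8⟩ :=
    exists_nonisolated_seq (L := M - 2 * r) (by omega) r n (by omega)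
  obtain ⟨s, hs, hk, hI⟩ := exists_config_of_seq hn h1 h2
  refine ⟨s, hs, ?_, fun i hi => ?_⟩
  · have hNn : (N : ℝ) = n + 1 := by exact_mod_cast hn
    rw [h3, h4, h5] at hI
    have : (interfaces s : ℝ) = (2 * r + 2 : ℕ) := by rw [hI, hNn]; push_cast; ring
    exact_mod_cast this
  · obtain ⟨k, hkN, rfl⟩ : ∃ k : ℕ, k < N ∧ (k : ZMod N) = i :=
      ⟨i.val, ZMod.val_lt i, ZMod.natCast_zmod_val i⟩
    obtain ⟨a, b⟩ := hi
    rcases Nat.eq_zero_or_pos k with rfl | hpos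
    · have k1 := hk 1 (by omega)
      rw [hk 0 (by omega), h4] at b
      push_cast at b k1
      rw [zero_add, k1, h6] at b
      exact b rfl
    · have k1 : (k : ZMod N) - 1 = ((k - 1 : ℕ) : ZMod N) := by
        rw [Nat.cast_sub hpos]; simp
      rw [k1, hk _ (by omega), hk _ hkN] at a
      by_cases hlast : k = n
      · subst hlast
        rw [h5] at a
        exact a (h7 _ (by omega))
      · have k2 : (k : ZMod N) + 1 = ((k + 1 : ℕ) : ZMod N) := by push_cast; ring
        rw [k2, hk (k + 1) (by omega), hk k hkN] at b
        obtain ⟨k, rfl⟩ : ∃ k', k = k' + 1 := ⟨k - 1, by omega⟩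
        rw [Nat.add_sub_cancel] at a
        exact b (h8 k (by omega) a)

/-! ### The metastable hierarchy -/

section CommHeight

variable {X : Type*} [TopologicalSpace X]

/-- The lower bound `b` is needed because `sInf` of a set unbounded below takes the default value 0.
-/
theorem commHeight_le {V : X → ℝ} (hV : Continuous V) {b L : ℝ} (hb : ∀ x, b ≤ V x) {x y : X}
    {S : Set X} (hy : y ∈ S) (h : JoinedIn {z | V z ≤ L} x y) :
    commHeight V x S ≤ L - V x := by
  obtain ⟨p, hp⟩ := h
  unfold commHeight
  refine sub_le_sub_right ?_ _
  refine le_trans (csInf_le ⟨b, ?_⟩ ?_) (ciSup_le hp)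
  swap
  · exact ⟨y, hy, p, rfl⟩
  rintro _ ⟨z, -, q, rfl⟩
  have hbdd : BddAbove (Set.range fun t => V (q t)) :=
    (isCompact_range (hV.comp q.continuous)).bddAbove
  exact (hb (q 0)).trans (le_ciSup hbdd 0)

/-- Every path leaving W meets its frontier. Nonemptiness of S and path-connectedness exclude the
default value of `sInf ∅`. -/
theorem le_commHeight [PathConnectedSpace X] {V : X → ℝ} (hV : Continuous V) {L : ℝ} {x : X}
    {S W : Set X} (hS : S.Nonempty) (hW : IsOpen W) (hx : x ∈ W) (hSW : ∀ y ∈ S, y ∉ W)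
    (hL : ∀ y ∈ frontier W, L ≤ V y) : L - V x ≤ commHeight V x S := by
  obtain ⟨y, hy⟩ := hS
  unfold commHeight
  refine sub_le_sub_right ?_ _
  refine le_csInf ⟨_, y, hy, (PathConnectedSpace.joined x y).somePath, rfl⟩ ?_
  rintro _ ⟨z, hz, q, rfl⟩
  obtain ⟨t, ht⟩ := exists_mem_frontier hW hx (hSW z hz) q
  have hbdd : BddAbove (Set.range fun t => V (q t)) :=
    (isCompact_range (hV.comp q.continuous)).bddAbove
  exact (hL _ ht).trans (le_ciSup hbdd t)

end CommHeight

/-! ### Costs of the families -/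

theorem maxUnlike_eq_one {s : hyperplane N} (h : ∀ i, ¬ IsIsolated s i) : maxUnlike s = 1 := by
  unfold maxUnlike
  exact if_neg fun ⟨i, hi⟩ => h i hi

theorem maxUnlike_eq_two {s : hyperplane N} (h : ∃ i, IsIsolated s i) : maxUnlike s = 2 := by
  unfold maxUnlike
  exact if_pos h

/-- When p > N/2, an isolated site is forced by `two_mul_interfaces_le`. -/
theorem maxUnlike_of_mem_A (hN2 : Even N) {p : ℕ} (hp : 4 ≤ p) {s : hyperplane N}
    (h : s ∈ A N p) : maxUnlike s = 2 := by
  obtain ⟨-, h1, h2⟩ := h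
  refine maxUnlike_eq_two ?_
  by_cases hpN : p ≤ N / 2
  · exact h2 hp hpN
  · by_contra hcon
    push Not at hcon
    have := two_mul_interfaces_le hcon
    obtain ⟨M, hM⟩ := hN2
    omega

theorem maxUnlike_of_mem_A_two (hN : 8 ≤ N) (hN2 : Even N) {s : hyperplane N} (h : s ∈ A N 2) :
    maxUnlike s = 1 :=
  maxUnlike_eq_one (((mem_B₀_iff hN2).1 h.1).not_isolated_of_two hN h.2.1)

/-- Strict decrease of the cost along the list drives the hierarchy, and also shows that the
families are disjoint. -/
theorem families_pairwise (hN : 8 ≤ N) (hN2 : Even N) :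
    (families N).Pairwise fun S T => ∀ y ∈ S, ∀ x ∈ T, cost x < cost y := by
  rw [families, List.pairwise_append, List.pairwise_append, List.pairwise_map, List.pairwise_map]
  refine ⟨⟨List.pairwise_singleton _ _, ?_, ?_⟩, ?_, ?_⟩
  · refine List.pairwise_lt_range.imp fun {i j} hij y hy x hx => ?_
    refine cost_lt_of_maxUnlike_eq hN ?_ ?_
    · rw [maxUnlike_eq_one hy.2.2, maxUnlike_eq_one hx.2.2]
    · rw [hy.2.1, hx.2.1]; omega
  · intro S hS T hT y hy x hx
    rw [List.mem_singleton] at hS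
    subst hS
    obtain ⟨j, -, rfl⟩ := List.mem_map.1 hT
    refine cost_lt_of_maxUnlike_eq hN ?_ ?_
    · rw [maxUnlike_of_mem_A_two hN hN2 hy, maxUnlike_eq_one hx.2.2]
    · rw [hy.2.1, hx.2.1]; omega
  · refine List.pairwise_lt_range.imp fun {i j} hij y hy x hx => ?_
    refine cost_lt_of_maxUnlike_eq hN ?_ ?_
    · rw [maxUnlike_of_mem_A hN2 (by omega) hy, maxUnlike_of_mem_A hN2 (by omega) hx]
    · rw [hy.2.1, hx.2.1]; omega
  · intro S hS T hT y hy x hx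
    obtain ⟨j, -, rfl⟩ := List.mem_map.1 hT
    refine cost_lt_of_isolated hN ?_ (maxUnlike_of_mem_A hN2 (by omega) hx)
    rcases List.mem_append.1 hS with hS | hS
    · rw [List.mem_singleton] at hS
      subst hS
      exact maxUnlike_of_mem_A_two hN hN2 hy
    · obtain ⟨i, -, rfl⟩ := List.mem_map.1 hS
      exact maxUnlike_eq_one hy.2.2

theorem mem_families {S : Set (hyperplane N)} : S ∈ families N ↔ S = A N 2 ∨
    (∃ j < N / 2 / 2 - 1, S = A' N (2 * j + 4)) ∨ ∃ j < N / 2 - 1, S = A N (2 * j + 4) := by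
  simp only [families, List.mem_append, List.mem_map, List.mem_range, List.mem_singleton, or_assoc]
  simp only [eq_comm (a := S)]

theorem cost_eq_of_mem_family (hN2 : Even N) {S : Set (hyperplane N)} (hN : 8 ≤ N)
    (hS : S ∈ families N) {x y : hyperplane N} (hx : x ∈ S) (hy : y ∈ S) : cost x = cost y := by
  rcases mem_families.1 hS with rfl | ⟨j, -, rfl⟩ | ⟨j, -, rfl⟩
  · rw [cost, cost, hx.2.1, hy.2.1, maxUnlike_of_mem_A_two hN hN2 hx,
      maxUnlike_of_mem_A_two hN hN2 hy]
  · rw [cost, cost, hx.2.1, hy.2.1, maxUnlike_eq_one hx.2.2, maxUnlike_eq_one hy.2.2]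
  · rw [cost, cost, hx.2.1, hy.2.1, maxUnlike_of_mem_A hN2 (by omega) hx,
      maxUnlike_of_mem_A hN2 (by omega) hy]

theorem family_subset {S : Set (hyperplane N)} (hS : S ∈ families N) : S ⊆ B₀ N := by
  rcases mem_families.1 hS with rfl | ⟨j, -, rfl⟩ | ⟨j, -, rfl⟩ <;> exact fun x hx => hx.1

theorem family_nonempty (hN2 : Even N) (hN : 8 ≤ N) {S : Set (hyperplane N)}
    (hS : S ∈ families N) : S.Nonempty := by
  rcases mem_families.1 hS with rfl | ⟨j, hj, rfl⟩ | ⟨j, hj, rfl⟩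
  · obtain ⟨s, hs, hI, -⟩ := exists_config_isolated hN2 0 (by omega)
    exact ⟨s, (mem_B₀_iff hN2).2 hs, hI, by omega⟩
  · obtain ⟨s, hs, hI, hi⟩ := exists_config_nonisolated hN2 (j + 1) (by omega)
    exact ⟨s, (mem_B₀_iff hN2).2 hs, by rw [hI]; ring, hi⟩
  · obtain ⟨s, hs, hI, hi⟩ := exists_config_isolated hN2 (j + 1) (by omega)
    exact ⟨s, (mem_B₀_iff hN2).2 hs, by rw [hI]; ring, fun _ _ => hi (by omega)⟩

theorem exists_family (hN2 : Even N) {s : hyperplane N} (hs : s ∈ B₀ N) :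
    ∃ S ∈ families N, s ∈ S := by
  have hc := (mem_B₀_iff hN2).1 hs
  obtain ⟨a, ha⟩ := hc.even_interfaces
  have h2 := hc.two_le_interfaces
  have hle := interfaces_le s
  obtain ⟨M, hM⟩ := hN2
  rcases Nat.eq_or_lt_of_le h2 with h | h
  · exact ⟨A N 2, mem_families.2 (Or.inl rfl), hs, h.symm, by omega⟩
  · by_cases hi : ∃ i, IsIsolated s i
    · exact ⟨A N (2 * (a - 2) + 4), mem_families.2 (Or.inr (Or.inr ⟨a - 2, by omega, rfl⟩)), hs,
        by omega, fun _ _ => hi⟩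
    · push Not at hi
      have := two_mul_interfaces_le hi
      exact ⟨A' N (2 * (a - 2) + 4), mem_families.2 (Or.inr (Or.inl ⟨a - 2, by omega, rfl⟩)), hs,
        by omega, hi⟩

theorem IsConfig.cost_le_of_two (hN : 8 ≤ N) {s y : hyperplane N} (hs : IsConfig s)
    (hI : interfaces s = 2) (hy : IsConfig y) : cost y ≤ cost s := by
  have h1 : maxUnlike s = 1 := maxUnlike_eq_one (hs.not_isolated_of_two hN hI)
  by_cases h : ∃ i, IsIsolated y i
  · exact (cost_lt_of_isolated hN h1 (maxUnlike_eq_two h)).le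
  · push Not at h
    have h2 := maxUnlike_eq_one h
    rcases Nat.eq_or_lt_of_le hy.two_le_interfaces with h3 | h3
    · rw [cost, cost, h1, h2, hI, ← h3]
    · exact (cost_lt_of_maxUnlike_eq hN (h1.trans h2.symm) (by omega)).le

/-- The minima at weak coupling are connected at low energy to those without coupling. -/
theorem eventually_joinedIn_branch (hN : 8 ≤ N) :
    ∀ᶠ γ in nhdsWithin (0 : ℝ) (Set.Ioi 0), ∀ s : hyperplane N, IsConfig s →
      JoinedIn {x | V N γ x ≤ height N / 2 - N / 4} (branch s γ) s := by
  -- On the segment `excess` is at most (6/5)·5Nγ and the coupling at most (5/4)Nγ, together below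
  -- 8Nγ.
  filter_upwards [eventually_mul_lt (C := 8 * N) (half_pos (height_pos hN)), self_mem_nhdsWithin]
    with γ h1 hγ s hs
  have hγ : 0 < γ := hγ
  refine JoinedIn.ofLine (f := fun θ : ℝ => (AffineMap.lineMap (branch s γ) s θ : hyperplane N))
    AffineMap.lineMap_continuous.continuousOn (by simp) (by simp) ?_
  rintro _ ⟨θ, hθ, rfl⟩
  change V N γ (AffineMap.lineMap (branch s γ) s θ) ≤ _
  have hb := branch_mem s γ
  have hN0 : (0 : ℝ) ≤ N := by positivity
  have hd := hs.sum_sq_branch_sub_le (γ := 0) (γ' := γ) le_rfl (by norm_num)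
  rw [hs.branch_zero, zero_sub, abs_neg, abs_of_pos hγ] at hd
  have hco : ∀ k, (AffineMap.lineMap (branch s γ) s θ : hyperplane N).1 k - s.1 k
      = (1 - θ) * ((branch s γ).1 k - s.1 k) := fun k => by rw [lineMap_apply_coord]; ring
  have hmem : (AffineMap.lineMap (branch s γ) s θ : hyperplane N) ∈ box s := by
    intro k
    rw [hco, abs_mul, abs_of_nonneg (by linarith [hθ.2])]
    exact (mul_le_of_le_one_left (abs_nonneg _) (by linarith [hθ.1])).trans (hb k)
  generalize (AffineMap.lineMap (branch s γ) s θ : hyperplane N) = x at *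
  have hg := hs.gradSq_box_le hmem
  have he : excess x ≤ 6 / 5 * ∑ k, ((branch s γ).1 k - s.1 k) ^ 2 := by
    rw [excess, Finset.mul_sum]
    refine Finset.sum_le_sum fun k _ => ?_
    have h2 := hs.mul_mem_box hmem k
    have e : (x.1 k ^ 2 - 1) ^ 2 = (x.1 k - s.1 k) ^ 2 * (1 + s.1 k * x.1 k) ^ 2 := by
      rcases hs k with h | h <;> rw [h] <;> ring
    have h3 : (1 + s.1 k * x.1 k) ^ 2 ≤ (21 / 10) ^ 2 :=
      pow_le_pow_left₀ (by linarith) (by linarith) 2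
    have h4 : (x.1 k - s.1 k) ^ 2 ≤ ((branch s γ).1 k - s.1 k) ^ 2 := by
      rw [hco, mul_pow]
      refine mul_le_of_le_one_left (sq_nonneg _) ?_
      exact pow_le_one₀ (by linarith [hθ.2]) (by linarith [hθ.1])
    rw [e]
    have h5 := mul_le_mul_of_nonneg_left h3 (sq_nonneg (x.1 k - s.1 k))
    nlinarith [sq_nonneg (x.1 k - s.1 k)]
  rw [V_eq]
  have := mul_le_mul_of_nonneg_left hg (div_nonneg hγ.le (by norm_num : (0 : ℝ) ≤ 4))
  have : 0 ≤ γ * N := by positivity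
  linarith

/-- At weak coupling: upper bounds for the communication heights to configurations of larger
cost. -/
theorem eventually_exists_joinedIn (hN : 8 ≤ N) {η : ℝ} (hη : 0 < η) {s : hyperplane N}
    (hs : IsConfig s) (hI : 4 ≤ interfaces s) :
    ∃ s' : hyperplane N, IsConfig s' ∧ cost s < cost s' ∧
      ∀ᶠ γ in nhdsWithin (0 : ℝ) (Set.Ioi 0), JoinedIn {x | V N γ x ≤ height N - N / 4
        + γ * (lev N (interfaces s) (maxUnlike s) + η)} (branch s γ) (branch s' γ) := by
  obtain ⟨s', hs', hc, hr⟩ := hs.exists_reach_lower hN hI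
  refine ⟨s', hs', hc, ?_⟩
  filter_upwards [hr η hη, eventually_joinedIn_branch hN, eventually_mul_lt
    (C := -(lev N (interfaces s) (maxUnlike s) + η)) (half_pos (height_pos hN))] with γ h1 h2 h3
  have hsub : {x | V N γ x ≤ height N / 2 - N / 4} ⊆ {x | V N γ x ≤ height N - N / 4
        + γ * (lev N (interfaces s) (maxUnlike s) + η)} := by
    intro x hx
    have hx : V N γ x ≤ _ := hx
    refine hx.trans ?_
    linarith
  exact (((h2 s hs).mono hsub).trans h1).trans ((h2 s' hs').mono hsub).symm

/-- There are finitely many configurations. The margin 4η pays 2η for the upper bound, η for the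
lower bound, and η for the gap of the hierarchy. -/
theorem exists_cost_gap : ∃ η : ℝ, 0 < η ∧ ∀ s : hyperplane N, IsConfig s →
    ∀ s' : hyperplane N, IsConfig s' → cost s < cost s' → cost s + 4 * η ≤ cost s' := by
  have h : ∀ᶠ η in nhdsWithin (0 : ℝ) (Set.Ioi 0), ∀ s ∈ {s : hyperplane N | IsConfig s},
      ∀ s' ∈ {s : hyperplane N | IsConfig s}, cost s < cost s' → cost s + 4 * η ≤ cost s' := by
    refine (Filter.eventually_all_finite isConfig_finite).2 fun s _ =>
      (Filter.eventually_all_finite isConfig_finite).2 fun s' _ => ?_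
    by_cases hc : cost s < cost s'
    · filter_upwards [eventually_mul_lt (C := 4) (sub_pos.2 hc)] with η h _
      linarith
    · exact Filter.Eventually.of_forall fun _ h => absurd h hc
  obtain ⟨η, h1, h2⟩ := (h.and self_mem_nhdsWithin).exists
  exact ⟨η, h2, fun s hs s' hs' => h1 s hs s' hs'⟩

/-- First-order bounds for the communication heights. -/
theorem eventually_commHeight (hN : 8 ≤ N) (hN2 : Even N) {η : ℝ} (hη : 0 < η) :
    ∀ᶠ γ in nhdsWithin (0 : ℝ) (Set.Ioi 0), ∀ s ∈ {s : hyperplane N | IsConfig s},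
      (4 ≤ interfaces s → ∃ s' : hyperplane N, IsConfig s' ∧ cost s < cost s' ∧
        ∀ S : Set (hyperplane N), branch s' γ ∈ S →
          commHeight (V N γ) (branch s γ) S ≤ height N + γ * (cost s + 2 * η)) ∧
      ∀ S : Set (hyperplane N), S.Nonempty →
        (∀ y ∈ S, ∃ s' : hyperplane N, IsConfig s' ∧ s' ≠ s ∧ y = branch s' γ) →
        height N + γ * (cost s - η) ≤ commHeight (V N γ) (branch s γ) S := by
  refine (Filter.eventually_all_finite isConfig_finite).2 fun s hs => ?_
  have hs : IsConfig s := hs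
  refine Filter.Eventually.and ?_ ?_
  · by_cases hI : 4 ≤ interfaces s
    · obtain ⟨s', hs', hc, hj⟩ := eventually_exists_joinedIn hN hη hs hI
      filter_upwards [hj, eventually_mul_lt (C := N * (4 / (9 / 10))) hη, self_mem_nhdsWithin]
        with γ h1 h2 hγ _
      have hγ : 0 < γ := hγ
      refine ⟨s', hs', hc, fun S hS => ?_⟩
      refine (commHeight_le (continuous_V γ) (b := -(N / 4)) (fun x => ?_) hS h1).trans ?_
      · rw [V_eq]
        have := excess_nonneg x
        have := mul_nonneg (div_nonneg hγ.le (by norm_num : (0 : ℝ) ≤ 4)) (gradSq_nonneg x)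
        linarith
      -- The minimum may lie below the energy of s by O(γ²); the second η absorbs this.
      · have h3 := hs.V_branch_ge hγ.le
        have h4 := mul_le_mul_of_nonneg_left h2.le hγ.le
        have e : (N : ℝ) * (4 * γ ^ 2 / (9 / 10)) = γ * (γ * (N * (4 / (9 / 10)))) := by ring
        rw [e] at h3
        rw [cost]
        linarith
    · exact Filter.Eventually.of_forall fun _ h => absurd h hI
  · filter_upwards [eventually_frontier_ge hN hN2 hs hs.unlike_le hη, self_mem_nhdsWithin]
      with γ h1 hγ S hS hSs
    have hγ : 0 < γ := hγ
    refine le_trans ?_ (le_commHeight (continuous_V γ) hS (isOpen_basin s)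
      (hs.branch_mem_basin hN γ) (fun y hy => ?_) h1)
    · have := hs.V_branch_le γ
      rw [cost]
      linarith
    · obtain ⟨s', hs', hne, rfl⟩ := hSs y hy
      exact hs.branch_notMem_basin hN hs' hne γ

end MassAC
end

/-! ### Assembly of the hierarchy -/

theorem theorem4p7 (N : ℕ) [NeZero N] (hN : 8 ≤ N) (hN2 : Even N) (hN3 : ¬ 3 ∣ N) :
    ∃ γ₀ : ℝ, 0 < γ₀ ∧ ∃ c : MassAC.hyperplane N → ℝ → MassAC.hyperplane N,
      (∀ x₀ ∈ MassAC.B₀ N, MassAC.IsContinuation γ₀ x₀ (c x₀) ∧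
        ∀ c' : ℝ → MassAC.hyperplane N, MassAC.IsContinuation γ₀ x₀ c' →
          Set.EqOn c' (c x₀) (Set.Ico 0 γ₀)) ∧
      ∀ γ ∈ Set.Ioo 0 γ₀,
        Set.InjOn (fun x₀ => c x₀ γ) (MassAC.B₀ N) ∧
        MassAC.IsMetastableHierarchy (MassAC.V N γ) ((fun x₀ => c x₀ γ) '' MassAC.B₀ N)
          (fun k : Fin (MassAC.families N).length =>
            (fun x₀ => c x₀ γ) '' (MassAC.families N).get k) := by
  open MassAC in
  obtain ⟨η, hη, hgap⟩ := exists_cost_gap (N := N)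
  obtain ⟨γ₁, hγ₁, H⟩ := mem_nhdsGT_iff_exists_Ioo_subset.1 (eventually_commHeight hN hN2 hη)
  have hN0 : (0 : ℝ) < N := by exact_mod_cast (by omega : 0 < N)
  have hγ₁ : 0 < γ₁ := hγ₁
  -- Below 1/(200N) the minimizers are interior to their boxes; below γ₁ the estimates of the
  -- communication heights hold.
  refine ⟨min γ₁ (1 / (200 * N)), lt_min hγ₁ (by positivity), branch, ?_, ?_⟩
  · have hle : min γ₁ (1 / (200 * N)) * N ≤ 1 / 200 := by
      refine (mul_le_mul_of_nonneg_right (min_le_right _ _) hN0.le).trans (le_of_eq ?_)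
      field_simp
    intro s hs
    have hs := (mem_B₀_iff hN2).1 hs
    exact ⟨hs.isContinuation_branch hle, fun c hc => hs.continuation_unique hle hc⟩
  · intro γ hγ
    have hγ0 : 0 < γ := hγ.1
    have hγN : γ * N < 1 / 200 := by
      have := mul_lt_mul_of_pos_right (lt_of_lt_of_le hγ.2 (min_le_right _ _)) hN0
      have e : 1 / (200 * (N : ℝ)) * N = 1 / 200 := by field_simp
      linarith
    have Hγ := H ⟨hγ0, lt_of_lt_of_le hγ.2 (min_le_left _ _)⟩
    have hB : ∀ {s}, s ∈ B₀ N → IsConfig s := fun h => (mem_B₀_iff hN2).1 h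
    have hinj : Set.InjOn (fun s : hyperplane N => branch s γ) (B₀ N) :=
      branch_injOn.mono fun s hs => hB hs
    have hpw := List.pairwise_iff_get.1 (families_pairwise hN hN2)
    have hsub : ∀ k, (families N).get k ⊆ B₀ N := fun k => family_subset (List.get_mem _ _)
    have hdisj : ∀ k l s, s ∈ (families N).get k → s ∈ (families N).get l → k = l := by
      intro k l s hk hl
      rcases lt_trichotomy k l with h | h | h
      · exact absurd (hpw k l h s hk s hl) (lt_irrefl _)
      · exact h
      · exact absurd (hpw l k h s hl s hk) (lt_irrefl _)
    have hcover : ∀ s ∈ B₀ N, ∃ k, s ∈ (families N).get k := by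
      intro s hs
      obtain ⟨S, hS, hsS⟩ := exists_family hN2 hs
      obtain ⟨k, rfl⟩ := List.get_of_mem hS
      exact ⟨k, hsS⟩
    refine ⟨hinj, ?_, ?_, ?_, ?_, γ * η, by positivity, ?_⟩
    · rintro _ ⟨s, hs, rfl⟩
      exact (hB hs).isLocalMin_branch hγ0.le hγN
    · exact fun k => (family_nonempty hN2 hN (List.get_mem _ _)).image _
    · intro k l hkl
      rw [Set.disjoint_left]
      rintro _ ⟨s, hs, rfl⟩ ⟨s', hs', h⟩
      have := hinj (hsub l hs') (hsub k hs) h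
      subst this
      exact hkl (hdisj k l s' hs hs')
    · rw [← Set.image_iUnion]
      congr 1
      refine Set.Subset.antisymm (Set.iUnion_subset hsub) fun s hs => ?_
      exact Set.mem_iUnion.2 (hcover s hs)
    · rintro k l hlk _ ⟨s, hs, rfl⟩ _ ⟨y, hy, rfl⟩
      have hsc := hB (hsub k hs)
      have hyc := hB (hsub l hy)
      have hcost := hpw l k hlk y hy s hs
      -- Configurations with two interfaces have the largest cost, whereas s costs strictly less
      -- than y.
      have hI : 4 ≤ interfaces s := by
        by_contra hI
        obtain ⟨a, ha⟩ := hsc.even_interfaces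
        have := hsc.two_le_interfaces
        exact absurd (hsc.cost_le_of_two hN (by omega) hyc) (not_le.2 hcost)
      obtain ⟨s', hs', hc, hup⟩ := (Hγ s hsc).1 hI
      obtain ⟨i, hi⟩ := hcover s' ((mem_B₀_iff hN2).2 hs')
      -- The cost is constant on each family and decreases along the list, so the costlier s' lies
      -- in an earlier family.
      have hik : i < k := by
        rcases lt_trichotomy i k with h | h | h
        · exact h
        · subst h
          exact absurd (cost_eq_of_mem_family hN2 hN (List.get_mem _ _) hs hi) hc.ne
        · exact absurd (hpw k i h s hs s' hi) (not_lt.2 hc.le)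
      have h1 := hup (⋃ i : Fin (families N).length, ⋃ _ : i < k,
          (fun x₀ => branch x₀ γ) '' (families N).get i)
        (Set.mem_iUnion₂.2 ⟨i, hik, s', hi, rfl⟩)
      have h2 := (Hγ y hyc).2 ((⋃ i : Fin (families N).length, ⋃ _ : i ≤ k,
          (fun x₀ => branch x₀ γ) '' (families N).get i)
          \ ((fun x₀ => branch x₀ γ) '' (families N).get l)) ?_ ?_
      -- The upper bound with cost s + 2η and the lower bound with cost y − η differ by at least γη,
      -- because cost s + 4η ≤ cost y.
      · have h3 := mul_le_mul_of_nonneg_left (hgap s hsc y hyc hcost) hγ0.le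
        linarith
      · refine ⟨branch s γ, Set.mem_iUnion₂.2 ⟨k, le_rfl, s, hs, rfl⟩, ?_⟩
        rintro ⟨s'', hs'', h⟩
        have := hinj (hsub l hs'') (hsub k hs) h
        subst this
        exact hlk.ne (hdisj l k s'' hs'' hs)
      · rintro _ ⟨hz, hzl⟩
        obtain ⟨i, -, s'', hs'', rfl⟩ := Set.mem_iUnion₂.1 hz
        refine ⟨s'', hB (hsub i hs''), ?_, rfl⟩
        rintro rfl
        exact hzl ⟨s'', hy, rfl⟩
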